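/- All entropies are Shannon entropies in bits, $h$ is the binary entropy function, and $\mathbb F_2$ is the binary field. **Protocol $P_0$.** Alice and Bob share a noiseless channel and a binary symmetric channel (BSC) with crossover probability $\varphi<1/2$; put $\epsilon=2\varphi(1-\varphi)$. Fix an $(n_0,k)$ binary linear code $C_0$ of rate $R_0=k/n_0$, and let $\mathbf H_1$ be a public, uniformly random $m\times n_0$ binary matrix. Alice has $x,y\in\mathbb F_2^m$. She sends $2n_0$ uniform bits $r_i$ over the BSC, each twice; Bob declares an erasure when the two received bits differ. Bob chooses a set $I$ of $n_0$ of the $2n_0$ indices, by any (possibly randomised) rule depending on what he received, and assigns $I$ to the secret he wants and the complement $J$ to the other secret. If Bob is honest, $I$ contains only non-erased indices (if fewer than $n_0$ indices are non-erased, $I$ contains all of these). He announces the two sets; Alice applies a uniformly random permutation to each and announces the permutations. She draws $c_x$ uniformly among the $c\in C_0$ with $\mathbf H_1c=x$, draws $c_y$ likewise for $y$, and sends noiselessly $c_x$ and $c_y$, each added to the (permuted) bits $r_i$ indexed by the set assigned to the corresponding secret; for a secret for which there is no such codeword she sends nothing. **Protocol $P_1$.** Let $\mathbf H$ be an $r\times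 n$ binary matrix with $\mathbf H\mathbf H^{\mathsf T}=\mathrm{Id}$, with rows $H_1,\dots,H_r$ generating a code $C$, and let $\hat C$ be the linear span of all componentwise products of two codewords of $C$. Alice has $\mathbf s,\mathbf t\in(\mathbb F_2^m)^r$. She picks $\mathbf x\in(\mathbb F_2^m)^n$ uniformly with $\mathbf H\mathbf x^{\mathsf T}=\mathbf s$ and sets $\mathbf y=\mathbf x+\sum_j(s_j+t_j)H_j$. Bob has a vector $\mathbf u\in\hat C^\perp$. For $\ell=1,\dots,n$, an independent run of $P_0$ on the pair $(x_\ell,y_\ell)$ is played, in which Bob asks for $x_\ell$ if $u_\ell=0$ and for $y_\ell$ if $u_\ell=1$ when he wants $\mathbf s$, and the other way round when he wants $\mathbf t$. All runs use the same $C_0$ and the same rule for choosing $I$. The uniform hashing matrices of the $n$ runs are drawn independently of everything else, and may have any joint law (for instance one common matrix, or independent ones). Bob's view $\mathcal O$ is everything that he observes, including the hashing matrices. **Statement.** Fix $\varphi\in[0,1/2)$. There are functions $m\mapsto f_0(m,\varepsilon)$, one for each $\varepsilon>0$, exponentially small in $m$ (that is, $|f_0(m,\varepsilon)|\le A e^{-\beta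 m}$ with $A$ and $\beta>0$ depending only on $\varphi$ and $\varepsilon$), such that the following holds for every $\varepsilon>0$, all $n_0,m$ and every $(n_0,k)$ linear code $C_0$ with $$m\le n_0\Bigl[R_0-(1-\epsilon)\Bigl(1-h\Bigl(\tfrac{\varphi^2}{1-\epsilon}\Bigr)\Bigr)-\varepsilon\Bigr].$$ 1. Let $P_0$ be played on independent uniform secrets, Alice being honest, and Bob honest or not but with a rule such that the set $J$ assigned to the other secret always contains at least as many erased indices as $I$. If $X$ is the other secret, $Y$ the secret asked for and $\mathcal O$ Bob's view, then $H(X\mid Y,\mathcal O)\ge m-f_0(m,\varepsilon)$. 2. Let $P_1$ be played by an honest Alice and an honest Bob, with any $r,n,\mathbf H,\mathbf u$ as above, on independent uniform secrets $S,T\in(\mathbb F_2^m)^r$. If Bob asks for $S$, then $$H(T\mid S,\mathcal O)\ \ge\ rm-n\,f_0(m,\varepsilon),$$ and if he asks for $T$, then $H(S\mid T,\mathcal O)\ge rm-n\,f_0(m,\varepsilon)$. -/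

import Mathlib

noncomputable section

namespace OT

/-! ### Shannon entropy (in bits) of finite distributions -/

/-- Shannon entropy, in bits, of a mass function `w` on a finite set. -/
def shannon {α : Type} [Fintype α] (w : α → ℝ) : ℝ :=
  (∑ a, Real.negMulLog (w a)) / Real.log 2

/-- Conditional Shannon entropy `H(A | B) = ∑ b, P(B = b) * H(A | B = b)`, in bits, where `p` is
the joint law of `(A, B)`. -/
def condEntropy {α β : Type} [Fintype α] [Fintype β] (p : PMF (α × β)) : ℝ :=
  ∑ b, ((p.map Prod.snd) b).toReal *
    shannon fun a => (p (a, b)).toReal / ((p.map Prod.snd) b).toReal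

/-- The binary entropy function, in bits. -/
def binEnt (p : ℝ) : ℝ := Real.binEntropy p / Real.log 2

/-- `f` is exponentially small in its argument. -/
def ExponentiallySmall (f : ℕ → ℝ) : Prop :=
  ∃ A β : ℝ, 0 < β ∧ ∀ m : ℕ, |f m| ≤ A * Real.exp (-(β * m))

/-! ### Basic random experiments -/

/-- The law of a family of independent random variables, the `i`-th of law `p i`. -/
def indep {ι κ : Type} [Fintype ι] [DecidableEq ι] [Fintype κ] (p : ι → PMF κ) :
    PMF (ι → κ) :=
  PMF.ofFintype (fun f => ∏ i, p i (f i)) (by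
    have h : ∀ i, ∑ a, p i a = 1 := fun i => by
      have := (p i).tsum_coe
      rwa [tsum_fintype] at this
    rw [← Fintype.prod_sum]
    simp [h])

/-- One use of the binary symmetric channel of crossover probability `φ` on the input bit `a`. -/
def bsc (φ : unitInterval) (a : ZMod 2) : PMF (ZMod 2) :=
  (PMF.ofFintype (fun e : ZMod 2 => ENNReal.ofReal (if e = 1 then (φ : ℝ) else 1 - φ)) (by
    change ∑ e : Fin 2, ENNReal.ofReal (if e = 1 then (φ : ℝ) else 1 - φ) = 1
    rw [Fin.sum_univ_two, ← ENNReal.ofReal_add]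
    · simp
    · simpa using φ.2.2
    · simpa using φ.2.1)).map (fun e => a + e)

/-- The probability `2φ(1-φ)` that a duplicated bit is received as an erasure. -/
def erasureProb (φ : unitInterval) : ℝ := 2 * (φ : ℝ) * (1 - φ)

/-! ### The protocol `P₀` -/

/-- Binary strings of length `k`. -/
abbrev Bits (k : ℕ) := Fin k → ZMod 2

/-- What Bob receives from the noisy channel: `2 * n₀` pairs of bits. -/
abbrev Received (n₀ : ℕ) := Fin (2 * n₀) → ZMod 2 × ZMod 2

/-- The sets of `n₀` indices out of `2 * n₀`. -/
abbrev IndexSet (n₀ : ℕ) := {I : Finset (Fin (2 * n₀)) // I.card = n₀}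

/-- The complementary set of indices. -/
def IndexSet.other {n₀ : ℕ} (I : IndexSet n₀) : IndexSet n₀ :=
  ⟨I.1ᶜ, by rw [Finset.card_compl, Fintype.card_fin, I.2]; omega⟩

/-- The bits of `r` indexed by `I`, listed in the order given by the permutation `π`. -/
def restrict {n₀ : ℕ} (r : Bits (2 * n₀)) (I : IndexSet n₀) (π : Equiv.Perm (Fin n₀)) : Bits n₀ :=
  fun i => r (I.1.orderEmbOfFin I.2 (π i))

/-- The indices that Bob declares erased: the two bits of the received pair differ. -/
def erased {n₀ : ℕ} (z : Received n₀) : Finset (Fin (2 * n₀)) :=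
  Finset.univ.filter fun i => (z i).1 ≠ (z i).2

/-- A (possibly randomised) rule by which Bob, given what he received, chooses the index set that
he assigns to the secret he wants; the complementary set is assigned to the other secret. -/
abbrev Selection (n₀ : ℕ) := Received n₀ → PMF (IndexSet n₀)

/-- The selection rules of an honest Bob: the chosen set contains only non-erased indices. If
fewer than `n₀` indices are non-erased (so that this is impossible) it contains all of them. -/
def Selection.Honest {n₀ : ℕ} (sel : Selection n₀) : Prop :=
  ∀ z, ∀ I ∈ (sel z).support, Disjoint I.1 (erased z) ∨ (erased z)ᶜ ⊆ I.1

/-- The selection rules, of a possibly dishonest Bob, for which the set that is assigned to the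
other secret always holds at least as many erased indices as the set assigned to the wanted
secret: the other secret is the one sent over the noisier of the two virtual channels. -/
def Selection.OtherIsNoisier {n₀ : ℕ} (sel : Selection n₀) : Prop :=
  ∀ z, ∀ I ∈ (sel z).support, (I.1 ∩ erased z).card ≤ (I.other.1 ∩ erased z).card

open Classical in
/-- Alice's choice of a codeword for the secret `x`: uniform among the codewords `c` of `C₀` with
`H₁ c = x`. If there is none, she cannot proceed with this secret and sends nothing (`none`). -/
def pickCodeword {n₀ m : ℕ} (C₀ : Submodule (ZMod 2) (Bits n₀))
    (H₁ : Matrix (Fin m) (Fin n₀) (ZMod 2)) (x : Bits m) : PMF (Option (Bits n₀)) :=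
  if h : (Finset.univ.filter fun c : Bits n₀ => c ∈ C₀ ∧ H₁.mulVec c = x).Nonempty then
    (PMF.uniformOfFinset _ h).map some
  else PMF.pure none

/-- What Bob sees in one run of `P₀` (apart from the public matrices and codes): the received pairs,
the index set that he chose, Alice's two permutations and her two noiseless messages. -/
abbrev View₀ (n₀ : ℕ) :=
  Received n₀ × IndexSet n₀ × (Equiv.Perm (Fin n₀) × Equiv.Perm (Fin n₀)) ×
    (Option (Bits n₀) × Option (Bits n₀))

/-- Protocol `P₀` run on the secrets `x` and `y` with the linear code `C₀` and the hashing matrix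
`H₁`, Bob asking for `x` if `a = 0` and for `y` if `a = 1`. The result is Bob's view. -/
def runP₀ (φ : unitInterval) {n₀ m : ℕ} (C₀ : Submodule (ZMod 2) (Bits n₀)) (sel : Selection n₀)
    (H₁ : Matrix (Fin m) (Fin n₀) (ZMod 2)) (a : ZMod 2) (x y : Bits m) : PMF (View₀ n₀) := do
  let r ← PMF.uniformOfFintype (Bits (2 * n₀))
  let z ← indep fun i => (do
    let b ← bsc φ (r i)
    let b' ← bsc φ (r i)
    pure (b, b') : PMF (ZMod 2 × ZMod 2))
  let I ← sel z
  let Ix : IndexSet n₀ := if a = 0 then I else I.other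
  let Iy : IndexSet n₀ := Ix.other
  let πx ← PMF.uniformOfFintype (Equiv.Perm (Fin n₀))
  let πy ← PMF.uniformOfFintype (Equiv.Perm (Fin n₀))
  let cx ← pickCodeword C₀ H₁ x
  let cy ← pickCodeword C₀ H₁ y
  pure (z, I, (πx, πy),
    (cx.map fun c => c + restrict r Ix πx, cy.map fun c => c + restrict r Iy πy))

/-- The joint law of `((X, Y), O)` where `X`, `Y` are independent uniform `m`-bit secrets and `O` is
all that Bob observes in `P₀`, including the uniformly random matrix `H₁`. -/
def lawP₀ (φ : unitInterval) {n₀ : ℕ} (m : ℕ) (C₀ : Submodule (ZMod 2) (Bits n₀))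
    (sel : Selection n₀) (a : ZMod 2) :
    PMF ((Bits m × Bits m) × (Matrix (Fin m) (Fin n₀) (ZMod 2) × View₀ n₀)) := do
  let x ← PMF.uniformOfFintype (Bits m)
  let y ← PMF.uniformOfFintype (Bits m)
  let H₁ ← PMF.uniformOfFintype (Matrix (Fin m) (Fin n₀) (ZMod 2))
  let o ← runP₀ φ C₀ sel H₁ a x y
  pure ((x, y), (H₁, o))

/-- Bob's uncertainty in bits on the secret that he did not ask for, given the secret that he asked
for and his observations. Here `a = 0` means that he asked for the first secret, and `p` is the
joint law of the two secrets and his observations. -/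
def residual {σ ω : Type} [Fintype σ] [Fintype ω] (a : ZMod 2) (p : PMF ((σ × σ) × ω)) : ℝ :=
  if a = 0 then condEntropy (p.map fun q => (q.1.2, (q.1.1, q.2)))
  else condEntropy (p.map fun q => (q.1.1, (q.1.2, q.2)))

/-! ### The protocol `P₁` -/

/-- The linear code generated by the rows of `H`. -/
def rowCode {r n : ℕ} (H : Matrix (Fin r) (Fin n) (ZMod 2)) : Submodule (ZMod 2) (Bits n) :=
  Submodule.span (ZMod 2) (Set.range fun i => H i)

/-- The Schur square of a code: the linear span of all componentwise products of codewords. -/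
def schurSquare {n : ℕ} (C : Submodule (ZMod 2) (Bits n)) : Submodule (ZMod 2) (Bits n) :=
  Submodule.span (ZMod 2) {w | ∃ c ∈ C, ∃ c' ∈ C, w = c * c'}

/-- The vectors `x = (x_1, …, x_n)` of `m`-bit strings with `H xᵀ = s`. Vectors of `m`-bit strings
are stored as matrices whose rows are the strings. -/
def maskSet {r n m : ℕ} (H : Matrix (Fin r) (Fin n) (ZMod 2))
    (s : Matrix (Fin r) (Fin m) (ZMod 2)) : Finset (Matrix (Fin n) (Fin m) (ZMod 2)) :=
  Finset.univ.filter fun x => H * x = s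

theorem maskSet_nonempty {r n m : ℕ} {H : Matrix (Fin r) (Fin n) (ZMod 2)}
    (hH : H * H.transpose = 1) (s : Matrix (Fin r) (Fin m) (ZMod 2)) : (maskSet H s).Nonempty :=
  ⟨H.transpose * s, by simp [maskSet, ← Matrix.mul_assoc, hH]⟩

/-- What Bob sees in `P₁`: the hashing matrices and his views of the `n` runs of `P₀`. (The
vector `u` and his request are fixed.) -/
abbrev View₁ (n₀ m n : ℕ) := (Fin n → Matrix (Fin m) (Fin n₀) (ZMod 2)) × (Fin n → View₀ n₀)

/-- Protocol `P₁` with honest Alice, generator matrix `H` and Bob's vector `u`, Bob asking for `s` if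
`a = 0` and for `t` if `a = 1`. The result is the joint law of `((S, T), O)` where `S`, `T` are
independent and uniform and `O` is Bob's view. In the `ℓ`-th run of `P₀` he asks for the string
`x_ℓ` if `u_ℓ + a = 0` and for `y_ℓ` if `u_ℓ + a = 1`, and that run uses the `ℓ`-th of the hashing
matrices, which have joint law `hash`. -/
def lawP₁ (φ : unitInterval) {n₀ m r n : ℕ} (C₀ : Submodule (ZMod 2) (Bits n₀))
    (sel : Selection n₀) (hash : PMF (Fin n → Matrix (Fin m) (Fin n₀) (ZMod 2)))
    (H : Matrix (Fin r) (Fin n) (ZMod 2)) (hH : H * H.transpose = 1) (u : Bits n) (a : ZMod 2) :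
    PMF ((Matrix (Fin r) (Fin m) (ZMod 2) × Matrix (Fin r) (Fin m) (ZMod 2)) ×
      View₁ n₀ m n) := do
  let s ← PMF.uniformOfFintype (Matrix (Fin r) (Fin m) (ZMod 2))
  let t ← PMF.uniformOfFintype (Matrix (Fin r) (Fin m) (ZMod 2))
  let x ← PMF.uniformOfFinset (maskSet H s) (maskSet_nonempty hH s)
  let y : Matrix (Fin n) (Fin m) (ZMod 2) := x + H.transpose * (s + t)
  let M ← hash
  let o ← indep fun l => runP₀ φ C₀ sel (M l) (u l + a) (x l) (y l)
  pure ((s, t), (M, o))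

end OT

end

noncomputable section

namespace OT

open Finset

/-! ### Point masses of finite distributions as real numbers -/

/-! Conditional entropy is bounded below by a divergence estimate (`variational_le_condEntropy`): if
the hidden secret together with Bob's data determines the sample point, any reference mass on Bob's
data gives a lower bound. It suffices to find a reference for the view that ignores the unwanted
secret and is close to the true law on average.

In one run the bits of the two index sets are independent, so the view factorises and only the
message for the other secret matters. It is a random codeword of given hash value plus noise; the
reference is a uniform codeword plus the same noise, smoothed with weight `η`. Pairwise independence
of linear hashing (`collision`) makes the averaged ratio at most `1 + excess`, the excess coming
from a codeword colliding with itself. The bound `log (1 + x) ≤ x ^ s / s` then yields a product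
over positions: an erased one contributes `1`, any other `noiseGen φ s`. The other set holds at most
half of the non-erased indices, so the square root of `noiseGen` may be charged to every non-erased
index; averaging over the received string gives a `2 * n₀`-th power. The slope of its exponent at `s
= 0` is the capacity in the rate condition, so a small fixed `s` leaves exponential decay.

For `P₁`, let `d = s + t`. Since `u` is orthogonal to the Schur square, `H diag(u) Hᵀ = 0`, and `H`
maps the strings that Bob asks for to the wanted secret (`mul_wanted`). Giving him all these strings
only lowers the entropy. With the other secret they determine `(x, d)`, so of `n m + r m` bits the
wanted strings take `n m` and `r m` remain. The log ratio of product laws is a sum over runs, so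
leakages add; only the marginal law of the strings and of the matrix of each run enters, which makes
correlated strings and a common hashing matrix harmless. -/

theorem toReal_bind {α β : Type} [Fintype α] (p : PMF α) (f : α → PMF β) (b : β) :
    ((p.bind f) b).toReal = ∑ a, (p a).toReal * (f a b).toReal := by
  rw [PMF.bind_apply, tsum_fintype, ENNReal.toReal_sum]
  · simp
  · intro a _
    exact ENNReal.mul_ne_top (p.apply_ne_top a) ((f a).apply_ne_top b)

theorem toReal_pure {α : Type} [DecidableEq α] (a b : α) :
    ((PMF.pure a : PMF α) b).toReal = if b = a then 1 else 0 := by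
  rw [PMF.pure_apply]
  by_cases h : b = a <;> simp [h]

theorem toReal_map {α β : Type} [Fintype α] [DecidableEq β] (p : PMF α) (f : α → β) (b : β) :
    ((p.map f) b).toReal = ∑ a, if b = f a then (p a).toReal else 0 := by
  rw [← PMF.bind_pure_comp, toReal_bind]
  refine sum_congr rfl fun a _ => ?_
  simp only [Function.comp, toReal_pure, mul_ite, mul_one, mul_zero]

theorem sum_toReal {α : Type} [Fintype α] (p : PMF α) : ∑ a, (p a).toReal = 1 := by
  rw [← ENNReal.toReal_sum fun a _ => p.apply_ne_top a]
  have := p.tsum_coe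
  rw [tsum_fintype] at this
  simp [this]

theorem toReal_uniform {α : Type} [Fintype α] [Nonempty α] (a : α) :
    ((PMF.uniformOfFintype α) a).toReal = (Fintype.card α : ℝ)⁻¹ := by
  simp

theorem toReal_indep {ι κ : Type} [Fintype ι] [DecidableEq ι] [Fintype κ] (p : ι → PMF κ)
    (f : ι → κ) : ((indep p) f).toReal = ∏ i, (p i (f i)).toReal := by
  simp [indep, PMF.ofFintype_apply, ENNReal.toReal_prod]

/-- A sum against a distribution over a product whose `l`-th marginal only is involved. -/
theorem sum_prod_mul_apply {ι κ : Type} [Fintype ι] [DecidableEq ι] [Fintype κ]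
    (p : ι → κ → ℝ) (hp : ∀ i, ∑ a, p i a = 1) (l : ι) (F : κ → ℝ) :
    ∑ f : ι → κ, (∏ i, p i (f i)) * F (f l) = ∑ a, p l a * F a := by
  have h : ∀ f : ι → κ, (∏ i, p i (f i)) * F (f l) =
      ∏ i, (p i (f i) * if i = l then F (f i) else 1) := by
    intro f
    rw [prod_mul_distrib, prod_ite_eq' univ l]
    simp
  simp_rw [h]
  rw [← Fintype.prod_sum (fun i a => p i a * if i = l then F a else 1),
    ← mul_prod_erase univ _ (mem_univ l)]
  have h2 : ∏ i ∈ univ.erase l, ∑ a, (p i a * if i = l then F a else 1) = 1 := by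
    refine prod_eq_one fun i hi => ?_
    simp [ne_of_mem_erase hi, hp]
  rw [h2]
  simp

theorem sum_map_mul {α β : Type} [Fintype α] [Fintype β] (p : PMF α) (f : α → β) (F : β → ℝ) :
    ∑ b, ((p.map f) b).toReal * F b = ∑ a, (p a).toReal * F (f a) := by
  classical
  simp_rw [toReal_map, sum_mul, ite_mul, zero_mul]
  rw [sum_comm]
  simp

/-! ### A variational lower bound on conditional entropy -/

theorem condEntropy_eq {α β : Type} [Fintype α] [Fintype β] (p : PMF (α × β)) :
    Real.log 2 * condEntropy p =
      ∑ ab : α × β, (p ab).toReal * Real.log (((p.map Prod.snd) ab.2).toReal / (p ab).toReal) := by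
  classical
  have hl : Real.log 2 ≠ 0 := (Real.log_pos one_lt_two).ne'
  rw [Fintype.sum_prod_type_right]
  unfold condEntropy
  rw [mul_sum]
  refine sum_congr rfl fun b _ => ?_
  unfold shannon
  rw [show ∀ x y : ℝ, Real.log 2 * (x * (y / Real.log 2)) = x * y by intros; field_simp, mul_sum]
  refine sum_congr rfl fun a _ => ?_
  rcases eq_or_ne (((p.map Prod.snd) b).toReal) 0 with h0 | h0
  · have : (p (a, b)).toReal = 0 := by
      rw [toReal_map] at h0
      have := (sum_eq_zero_iff_of_nonneg (fun x _ => by positivity)).1 h0 (a, b) (mem_univ _)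
      simpa using this
    simp [this]
  · rw [Real.negMulLog, ← inv_div (p (a, b)).toReal, Real.log_inv]
    field_simp

/-- Gibbs' inequality. Refining `β` to `β'` can only lower the entropy of `α`; as `(α, β')`
determines `ω`, the entropy of `α` given `β'` is `H(ω) - H(β')`, and `H(β')` is at most the cross
entropy against a subprobability `q`. The proof performs both comparisons at once, termwise. -/
theorem variational_le_condEntropy {Ω A B B' : Type} [Fintype Ω] [Fintype A] [Fintype B]
    [Fintype B'] (p : PMF Ω) (α : Ω → A) (β : Ω → B) (β' : Ω → B') (f : B' → B)
    (hf : ∀ ω, β ω = f (β' ω)) (hinj : Function.Injective fun ω => (α ω, β' ω))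
    (q : B' → ℝ) (hq : ∀ b, 0 ≤ q b) (hq1 : ∑ b, q b ≤ 1)
    (hpos : ∀ ω, (p ω).toReal ≠ 0 → 0 < q (β' ω)) :
    ∑ ω, (p ω).toReal * Real.log (q (β' ω) / (p ω).toReal) ≤
      Real.log 2 * condEntropy (p.map fun ω => (α ω, β ω)) := by
  classical
  rw [condEntropy_eq, sum_map_mul, PMF.map_comp]
  set P : A → B → ℝ := fun a b => ((p.map fun ω => (α ω, β ω)) (a, b)).toReal with hP
  set PB : B → ℝ := fun b => ((p.map (Prod.snd ∘ fun ω => (α ω, β ω))) b).toReal with hPB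
  have hP0 : ∀ a b, 0 ≤ P a b := fun a b => ENNReal.toReal_nonneg
  have hPB0 : ∀ b, 0 ≤ PB b := fun b => ENNReal.toReal_nonneg
  have hsum : ∀ b, ∑ a, P a b = PB b := by
    intro b
    simp only [hP, hPB, toReal_map, Function.comp]
    rw [sum_comm]
    refine sum_congr rfl fun ω _ => ?_
    by_cases h : b = β ω <;> simp [h]
  have hPp : ∀ ω, (p ω).toReal ≤ P (α ω) (β ω) := by
    intro ω
    simp only [hP, toReal_map]
    refine le_trans ?_ (single_le_sum (fun x _ => by positivity) (mem_univ ω))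
    simp
  have hPPB : ∀ a b, P a b ≤ PB b := by
    intro a b
    rw [← hsum]
    exact single_le_sum (fun x _ => hP0 x b) (mem_univ a)
  rw [← sub_nonneg, ← sum_sub_distrib]
  -- This is `1 - 1/t ≤ log t` at the ratio `t` of the arguments of the two logarithms. It remains
  -- to see that the subtracted terms sum to at most `1`.
  have key : ∀ ω, (p ω).toReal - q (β' ω) * (P (α ω) (β ω) / PB (β ω)) ≤
      (p ω).toReal * Real.log (PB (β ω) / P (α ω) (β ω)) -
        (p ω).toReal * Real.log (q (β' ω) / (p ω).toReal) := by
    intro ω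
    rcases eq_or_ne (p ω).toReal 0 with h0 | h0
    · simp only [h0, zero_mul, zero_sub, sub_zero]
      have := mul_nonneg (hq (β' ω)) (div_nonneg (hP0 (α ω) (β ω)) (hPB0 (β ω)))
      linarith
    · have hp : 0 < (p ω).toReal := lt_of_le_of_ne ENNReal.toReal_nonneg (Ne.symm h0)
      have h1 : 0 < P (α ω) (β ω) := hp.trans_le (hPp ω)
      have h2 : 0 < PB (β ω) := h1.trans_le (hPPB _ _)
      have h3 := hpos ω h0
      rw [← mul_sub, ← Real.log_div (by positivity) (by positivity)]
      set t := PB (β ω) / P (α ω) (β ω) / (q (β' ω) / (p ω).toReal) with ht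
      have htp : 0 < t := by positivity
      have := Real.one_sub_inv_le_log_of_pos htp
      have h4 := mul_le_mul_of_nonneg_left this hp.le
      refine le_trans (le_of_eq ?_) h4
      rw [ht]
      field_simp
  refine le_trans ?_ (sum_le_sum fun ω _ => key ω)
  rw [sum_sub_distrib, sum_toReal, sub_nonneg]
  -- Injectivity of `(α, β')` lets the sum extend to all pairs, where the conditional law of `α`
  -- sums to at most `1`.
  calc ∑ ω, q (β' ω) * (P (α ω) (β ω) / PB (β ω))
      = ∑ x ∈ univ.image (fun ω => (α ω, β' ω)), q x.2 * (P x.1 (f x.2) / PB (f x.2)) := by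
        rw [sum_image hinj.injOn]
        exact sum_congr rfl fun ω _ => by simp [hf]
    _ ≤ ∑ x : A × B', q x.2 * (P x.1 (f x.2) / PB (f x.2)) :=
        sum_le_sum_of_subset_of_nonneg (subset_univ _) fun x _ _ =>
          mul_nonneg (hq _) (div_nonneg (hP0 _ _) (hPB0 _))
    _ = ∑ b, q b * ((∑ a, P a (f b)) / PB (f b)) := by
        rw [Fintype.sum_prod_type_right]
        simp [mul_sum, sum_div]
    _ ≤ ∑ b, q b := by
        refine sum_le_sum fun b _ => ?_
        rw [hsum]
        exact mul_le_of_le_one_right (hq b) (div_self_le_one _)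
    _ ≤ 1 := hq1

/-! ### The law of Bob's view in one run of `P₀` -/

/-- The joint mass of a uniform bit `b` and of the pair `z` received when `b` is sent twice. -/
def pairMass (φ : unitInterval) (b : ZMod 2) (z : ZMod 2 × ZMod 2) : ℝ :=
  2⁻¹ * ((bsc φ b z.1).toReal * (bsc φ b z.2).toReal)

/-- The joint mass of a uniform string `r` and of the string `z` of pairs received. -/
def blockMass (φ : unitInterval) {k : ℕ} (r : Bits k) (z : Fin k → ZMod 2 × ZMod 2) : ℝ :=
  ∏ j, pairMass φ (r j) (z j)

/-- The joint mass of the received block `z` and of Alice's message `o` for the secret `v`. -/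
def msgMass (φ : unitInterval) {n₀ m : ℕ} (C₀ : Submodule (ZMod 2) (Bits n₀))
    (M : Matrix (Fin m) (Fin n₀) (ZMod 2)) (v : Bits m) (z : Fin n₀ → ZMod 2 × ZMod 2)
    (o : Option (Bits n₀)) : ℝ :=
  ∑ r, blockMass φ r z * (((pickCodeword C₀ M v).map (Option.map fun c => c + r)) o).toReal

/-- The entries of `z` indexed by `I`, in the order given by `π`. -/
def subBlock {n₀ : ℕ} {α : Type} (z : Fin (2 * n₀) → α) (I : IndexSet n₀)
    (π : Equiv.Perm (Fin n₀)) : Fin n₀ → α :=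
  fun i => z (I.1.orderEmbOfFin I.2 (π i))

/-- The enumeration of all indices by those of `I` followed by those of its complement. -/
def splitEquiv {n₀ : ℕ} (I : IndexSet n₀) (π π' : Equiv.Perm (Fin n₀)) :
    Fin n₀ ⊕ Fin n₀ ≃ Fin (2 * n₀) :=
  (Equiv.sumCongr π π').trans (finSumEquivOfFinset I.2 I.other.2)

theorem splitEquiv_inl {n₀ : ℕ} (I : IndexSet n₀) (π π' : Equiv.Perm (Fin n₀)) (i : Fin n₀) :
    splitEquiv I π π' (Sum.inl i) = I.1.orderEmbOfFin I.2 (π i) :=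
  finSumEquivOfFinset_inl I.2 I.other.2 (π i)

theorem splitEquiv_inr {n₀ : ℕ} (I : IndexSet n₀) (π π' : Equiv.Perm (Fin n₀)) (i : Fin n₀) :
    splitEquiv I π π' (Sum.inr i) = I.other.1.orderEmbOfFin I.other.2 (π' i) :=
  finSumEquivOfFinset_inr I.2 I.other.2 (π' i)

/-- Splitting a family into the part indexed by `I` and the rest. -/
def splitFun {n₀ : ℕ} (α : Type) (I : IndexSet n₀) (π π' : Equiv.Perm (Fin n₀)) :
    (Fin (2 * n₀) → α) ≃ (Fin n₀ → α) × (Fin n₀ → α) :=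
  ((splitEquiv I π π').symm.arrowCongr (Equiv.refl α)).trans
    (Equiv.sumArrowEquivProdArrow _ _ _)

theorem splitFun_apply {n₀ : ℕ} {α : Type} (I : IndexSet n₀) (π π' : Equiv.Perm (Fin n₀))
    (z : Fin (2 * n₀) → α) :
    splitFun α I π π' z = (subBlock z I π, subBlock z I.other π') := by
  ext i <;> simp [splitFun, subBlock, Equiv.sumArrowEquivProdArrow, Equiv.arrowCongr,
    splitEquiv_inl, splitEquiv_inr]

theorem prod_split {n₀ : ℕ} (I : IndexSet n₀) (π π' : Equiv.Perm (Fin n₀))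
    (F : Fin (2 * n₀) → ℝ) :
    ∏ i, F i = (∏ i, subBlock F I π i) * ∏ i, subBlock F I.other π' i := by
  rw [← (splitEquiv I π π').prod_comp, Fintype.prod_sum_type]
  simp [splitEquiv_inl, splitEquiv_inr, subBlock]

theorem IndexSet.other_other {n₀ : ℕ} (I : IndexSet n₀) : I.other.other = I :=
  Subtype.ext (compl_compl I.1)

theorem sum_channel (φ : unitInterval) (b : ZMod 2) (z : ZMod 2 × ZMod 2) :
    ∑ c, (bsc φ b c).toReal * ∑ c', (bsc φ b c').toReal * (if z = (c, c') then 1 else 0) =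
      2 * pairMass φ b z := by
  obtain ⟨z1, z2⟩ := z
  simp only [Prod.mk.injEq, ite_and, mul_ite, mul_one, mul_zero]
  rw [sum_eq_single z1 (by intro c _ hc; simp [hc.symm]) (by simp)]
  simp [pairMass]

/-- The bits on complementary index sets are independent, and Bob's choice depends on them only
through `z`; so the two messages are independent given the rest of the view. -/
theorem toReal_runP₀ (φ : unitInterval) {n₀ m : ℕ} (C₀ : Submodule (ZMod 2) (Bits n₀))
    (sel : Selection n₀) (M : Matrix (Fin m) (Fin n₀) (ZMod 2)) (a : ZMod 2) (x y : Bits m)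
    (o : View₀ n₀) (Ix : IndexSet n₀) (hIx : Ix = if a = 0 then o.2.1 else o.2.1.other) :
    (runP₀ φ C₀ sel M a x y o).toReal =
      (sel o.1 o.2.1).toReal * ((Fintype.card (Equiv.Perm (Fin n₀)) : ℝ)⁻¹) ^ 2 *
        (msgMass φ C₀ M x (subBlock o.1 Ix o.2.2.1.1) o.2.2.2.1 *
          msgMass φ C₀ M y (subBlock o.1 Ix.other o.2.2.1.2) o.2.2.2.2) := by
  classical
  obtain ⟨z, I, ⟨πx, πy⟩, mx, my⟩ := o
  simp only at hIx ⊢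
  set N : ℝ := (Fintype.card (Equiv.Perm (Fin n₀)) : ℝ)⁻¹ with hN
  have h1 : (runP₀ φ C₀ sel M a x y (z, I, (πx, πy), mx, my)).toReal =
      ∑ r : Bits (2 * n₀), blockMass φ r z * ((sel z I).toReal * (N * (N *
        ((((pickCodeword C₀ M x).map (Option.map fun c => c + restrict r Ix πx)) mx).toReal *
        (((pickCodeword C₀ M y).map
          (Option.map fun c => c + restrict r Ix.other πy)) my).toReal)))) := by
    unfold runP₀
    simp only [bind, pure, toReal_bind, toReal_indep]
    refine sum_congr rfl fun r _ => ?_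
    rw [sum_eq_single z]
    · rw [sum_eq_single I]
      · rw [sum_eq_single πx]
        · rw [sum_eq_single πy]
          · rw [toReal_map, toReal_map, sum_mul_sum]
            simp only [toReal_uniform, toReal_pure]
            -- The factor `2` per pair cancels the uniform mass of `r`, because `pairMass` already
            -- contains the mass `1/2` of the bit.
            simp_rw [sum_channel]
            rw [← hIx, prod_mul_distrib, prod_const, card_univ, Fintype.card_fun, Fintype.card_fin,
              ZMod.card, mul_assoc, Nat.cast_pow, Nat.cast_ofNat,
              inv_mul_cancel_left₀ (by positivity : (2 : ℝ) ^ (2 * n₀) ≠ 0)]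
            refine congrArg _ (congrArg _ (congrArg _ (congrArg _ ?_)))
            refine sum_congr rfl fun i _ => ?_
            rw [mul_sum]
            refine sum_congr rfl fun j _ => ?_
            simp only [Prod.mk.injEq, true_and]
            split_ifs <;> simp_all
          · intro π _ h
            simp [h.symm]
          · simp
        · intro π _ h
          simp [h.symm]
        · simp
      · intro π _ h
        simp [h.symm]
      · simp
    · intro π _ h
      simp [h.symm]
    · simp
  rw [h1]
  have h2 : ∀ r : Bits (2 * n₀), blockMass φ r z =
      blockMass φ (subBlock r Ix πx) (subBlock z Ix πx) *
        blockMass φ (subBlock r Ix.other πy) (subBlock z Ix.other πy) :=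
    fun r => prod_split Ix πx πy fun i => pairMass φ (r i) (z i)
  unfold msgMass
  rw [sum_mul_sum, ← Fintype.sum_prod_type', ← (splitFun (ZMod 2) Ix πx πy).sum_comp, mul_sum]
  refine sum_congr rfl fun r _ => ?_
  rw [splitFun_apply, h2]
  change _ = _ * (_ * (((pickCodeword C₀ M x).map
    (Option.map fun c => c + restrict r Ix πx)) mx).toReal * (_ * (((pickCodeword C₀ M y).map
    (Option.map fun c => c + restrict r Ix.other πy)) my).toReal))
  ring

/-! ### Fibres of homomorphisms of finite groups -/

theorem card_le_card_mul_card_fiber {G H : Type} [AddGroup G] [Fintype G] [AddGroup H] [Fintype H]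
    [DecidableEq H]     (f : G →+ H) (x : G) :
    Fintype.card G ≤ Fintype.card H * #{y | f y = f x} := by
  rw [← card_univ, card_eq_sum_card_fiberwise (f := f) (t := univ) (fun _ _ => mem_univ _),
    ← card_univ, ← smul_eq_mul]
  refine sum_le_card_nsmul _ _ _ fun h _ => ?_
  by_cases hh : h ∈ Set.range f
  · obtain ⟨x', rfl⟩ := hh
    exact (AddMonoidHom.card_fiber_eq_of_mem_range f ⟨x', rfl⟩ ⟨x, rfl⟩).le
  · rw [card_eq_zero.2]
    · exact Nat.zero_le _
    · exact filter_eq_empty_iff.2 fun y _ hy => hh ⟨y, hy⟩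

theorem card_fiber_of_surjective {G H : Type} [AddGroup G] [Fintype G] [AddGroup H] [Fintype H]
    [DecidableEq H]     (f : G →+ H) (hf : Function.Surjective f) (h : H) :
    Fintype.card H * #{y | f y = h} = Fintype.card G := by
  rw [← card_univ (α := G),
    card_eq_sum_card_fiberwise (s := (univ : Finset G)) (f := f) (t := univ) (fun _ _ => mem_univ _),
    ← card_univ (α := H), ← smul_eq_mul]
  exact (sum_eq_card_nsmul fun h' _ =>
    AddMonoidHom.card_fiber_eq_of_mem_range f (hf h') (hf h)).symm

/-- Multiplication by a nonzero vector takes every value equally often on matrices. -/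
theorem sum_mulVec_eq {m n : ℕ} {d : Bits n} (hd : d ≠ 0) (v : Bits m) :
    (Fintype.card (Matrix (Fin m) (Fin n) (ZMod 2)) : ℝ)⁻¹ *
      ∑ M : Matrix (Fin m) (Fin n) (ZMod 2), (if M.mulVec d = v then (1 : ℝ) else 0) =
        ((2 : ℝ) ^ m)⁻¹ := by
  let f : Matrix (Fin m) (Fin n) (ZMod 2) →+ Bits m :=
    ⟨⟨fun M => M.mulVec d, by simp⟩, fun A B => by simp [Matrix.add_mulVec]⟩
  have hf : Function.Surjective f := by
    intro v
    obtain ⟨i, hi⟩ := Function.ne_iff.1 hd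
    have hi1 : d i = 1 := Fin.eq_one_of_ne_zero _ hi
    refine ⟨fun j k => if k = i then v j else 0, ?_⟩
    ext j
    simp [f, Matrix.mulVec, dotProduct, hi1]
  have h := card_fiber_of_surjective f hf v
  have h2 : (Fintype.card (Bits m) : ℝ) = 2 ^ m := by simp [ZMod.card]
  rw [sum_boole, ← h, Nat.cast_mul, h2]
  have h3 : (#{y | f y = v} : ℝ) ≠ 0 := by
    obtain ⟨y, hy⟩ := hf v
    exact_mod_cast (card_pos.2 ⟨y, by simpa using hy⟩).ne'
  change (2 ^ m * (#{y | f y = v} : ℝ))⁻¹ * (#{y | f y = v} : ℝ) = _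
  field_simp

/-! ### Alice's codewords -/

open Classical in
/-- The codewords of `C₀`, as a finite set. -/
def codewords {n : ℕ} (C₀ : Submodule (ZMod 2) (Bits n)) : Finset (Bits n) :=
  univ.filter fun c => c ∈ C₀

/-- The codewords with hash value `v`. -/
def hashFiber {n m : ℕ} (C₀ : Submodule (ZMod 2) (Bits n))
    (M : Matrix (Fin m) (Fin n) (ZMod 2)) (v : Bits m) : Finset (Bits n) :=
  (codewords C₀).filter fun c => M.mulVec c = v

theorem card_codewords {n : ℕ} (C₀ : Submodule (ZMod 2) (Bits n)) :
    #(codewords C₀) = 2 ^ Module.finrank (ZMod 2) C₀ := by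
  classical
  have h := Module.card_eq_pow_finrank (K := ZMod 2) (V := C₀)
  rw [ZMod.card] at h
  rw [← h, codewords, Fintype.card_subtype]

theorem card_codewords_pos {n : ℕ} (C₀ : Submodule (ZMod 2) (Bits n)) :
    (0 : ℝ) < #(codewords C₀) := by
  rw [card_codewords]; positivity

theorem card_le_hashFiber {n m : ℕ} (C₀ : Submodule (ZMod 2) (Bits n))
    (M : Matrix (Fin m) (Fin n) (ZMod 2)) {c : Bits n} (hc : c ∈ codewords C₀) :
    (#(codewords C₀) : ℝ) ≤ 2 ^ m * #(hashFiber C₀ M (M.mulVec c)) := by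
  classical
  have hc' : c ∈ C₀ := by simpa [codewords] using hc
  let f : C₀ →+ Bits m := (M.mulVecLin.domRestrict C₀).toAddMonoidHom
  have h := card_le_card_mul_card_fiber f ⟨c, hc'⟩
  have h1 : Fintype.card C₀ = #(codewords C₀) := by rw [codewords, Fintype.card_subtype]
  have h2 : Fintype.card (Bits m) = 2 ^ m := by simp [ZMod.card]
  have h3 : #{y | f y = f ⟨c, hc'⟩} = #(hashFiber C₀ M (M.mulVec c)) := by
    refine card_bij (fun y _ => y.1) ?_ ?_ ?_
    · intro y hy
      have hy' : M.mulVec y.1 = M.mulVec c := (mem_filter.1 hy).2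
      simp [hashFiber, codewords, hy']
    · intro y _ y' _ h
      exact Subtype.ext h
    · intro b hb
      simp only [hashFiber, codewords, mem_filter, mem_univ, true_and] at hb
      exact ⟨⟨b, hb.1⟩, mem_filter.2 ⟨mem_univ _, hb.2⟩, rfl⟩
  rw [h1, h2, h3] at h
  exact_mod_cast h

theorem pickCodeword_some {n m : ℕ} (C₀ : Submodule (ZMod 2) (Bits n))
    (M : Matrix (Fin m) (Fin n) (ZMod 2)) (v : Bits m) (c : Bits n) :
    (pickCodeword C₀ M v (some c)).toReal =
      if c ∈ hashFiber C₀ M v then (#(hashFiber C₀ M v) : ℝ)⁻¹ else 0 := by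
  classical
  have hF : (univ.filter fun c : Bits n => c ∈ C₀ ∧ M.mulVec c = v) = hashFiber C₀ M v := by
    ext; simp [hashFiber, codewords]
  unfold pickCodeword
  simp only [hF]
  split_ifs with h1 h2 h2
  · rw [toReal_map]
    simp [PMF.uniformOfFinset_apply, h2]
  · rw [toReal_map]
    simp [PMF.uniformOfFinset_apply, h2]
  · exact absurd ⟨c, h2⟩ h1
  · simp

theorem pickCodeword_none {n m : ℕ} (C₀ : Submodule (ZMod 2) (Bits n))
    (M : Matrix (Fin m) (Fin n) (ZMod 2)) (v : Bits m) :
    (pickCodeword C₀ M v none).toReal = if hashFiber C₀ M v = ∅ then 1 else 0 := by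
  classical
  have hF : (univ.filter fun c : Bits n => c ∈ C₀ ∧ M.mulVec c = v) = hashFiber C₀ M v := by
    ext; simp [hashFiber, codewords]
  unfold pickCodeword
  simp only [hF]
  split_ifs with h1 h2 h2
  · exact absurd h2 h1.ne_empty
  · rw [toReal_map]
    simp
  · simp
  · exact absurd (nonempty_iff_ne_empty.2 h2) h1

theorem sum_pickCodeword_some {n m : ℕ} (C₀ : Submodule (ZMod 2) (Bits n))
    (M : Matrix (Fin m) (Fin n) (ZMod 2)) (v : Bits m) :
    ∑ c, (pickCodeword C₀ M v (some c)).toReal = 1 - (pickCodeword C₀ M v none).toReal := by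
  have := sum_toReal (pickCodeword C₀ M v)
  rw [Fintype.sum_option] at this
  linarith

/-- A uniform secret followed by a codeword from its fibre is dominated by a uniform codeword: a
nonempty fibre is a coset of the kernel of the hash on `C₀`, so it has at least `#C₀ / 2 ^ m`
elements. -/
theorem pickCodeword_mulVec_le {n m : ℕ} (C₀ : Submodule (ZMod 2) (Bits n))
    (M : Matrix (Fin m) (Fin n) (ZMod 2)) (c : Bits n) (v : Bits m) :
    ((2 : ℝ) ^ m)⁻¹ * (pickCodeword C₀ M v (some c)).toReal ≤
      if c ∈ codewords C₀ ∧ M.mulVec c = v then (#(codewords C₀) : ℝ)⁻¹ else 0 := by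
  rw [pickCodeword_some]
  by_cases h : c ∈ codewords C₀ ∧ M.mulVec c = v
  · have h' : c ∈ hashFiber C₀ M v := by simpa [hashFiber] using h
    rw [if_pos h, if_pos h', ← mul_inv]
    have h2 := card_le_hashFiber C₀ M h.1
    rw [h.2] at h2
    exact inv_anti₀ (card_codewords_pos C₀) h2
  · have h' : c ∉ hashFiber C₀ M v := by simpa [hashFiber] using h
    simp [h, h']

/-- Pairwise independence of the hash values. -/
theorem collision {n m : ℕ} (c c' : Bits n) :
    (Fintype.card (Matrix (Fin m) (Fin n) (ZMod 2)) : ℝ)⁻¹ *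
      ∑ M : Matrix (Fin m) (Fin n) (ZMod 2), (if M.mulVec c' = M.mulVec c then (1 : ℝ) else 0) ≤
        ((2 : ℝ) ^ m)⁻¹ + if c' = c then 1 else 0 := by
  split_ifs with h
  · subst h
    simp only [if_true, sum_const, card_univ, nsmul_eq_mul, mul_one]
    rw [inv_mul_cancel₀ (by positivity)]
    have : 0 ≤ ((2 : ℝ) ^ m)⁻¹ := by positivity
    linarith
  · rw [add_zero, ← sum_mulVec_eq (sub_ne_zero.2 h) (0 : Bits m)]
    simp [Matrix.mulVec_sub, sub_eq_zero]

/-- The probability that a random hash value is not taken on the code. -/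
theorem avg_pickCodeword_none_le {n m : ℕ} (C₀ : Submodule (ZMod 2) (Bits n)) :
    (Fintype.card (Matrix (Fin m) (Fin n) (ZMod 2)) : ℝ)⁻¹ *
      ∑ M : Matrix (Fin m) (Fin n) (ZMod 2), ((2 : ℝ) ^ m)⁻¹ *
        ∑ v, (pickCodeword C₀ M v none).toReal ≤ 2 ^ m / #(codewords C₀) := by
  classical
  set K : ℝ := (#(codewords C₀) : ℝ) with hK
  have hKp : 0 < K := card_codewords_pos C₀
  set D : ℝ := 2 ^ m with hD
  have hDp : 0 < D := by positivity
  set W : ℝ := (Fintype.card (Matrix (Fin m) (Fin n) (ZMod 2)) : ℝ) with hW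
  have hWp : 0 < W := by rw [hW]; exact_mod_cast Fintype.card_pos
  -- Chebyshev: an empty fibre deviates from the mean size `K / D`, so its indicator is at most `(D
  -- / K * size - 1) ^ 2`.
  have hpt : ∀ (M : Matrix (Fin m) (Fin n) (ZMod 2)) v, (pickCodeword C₀ M v none).toReal ≤
      (D / K) ^ 2 * (#(hashFiber C₀ M v) : ℝ) ^ 2 - 2 * (D / K) * #(hashFiber C₀ M v) + 1 := by
    intro M v
    rw [pickCodeword_none]
    split_ifs with h
    · simp [h]
    · nlinarith [sq_nonneg ((D / K) * #(hashFiber C₀ M v) - 1)]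
  have hfib : ∀ (M : Matrix (Fin m) (Fin n) (ZMod 2)) v, (#(hashFiber C₀ M v) : ℝ) =
      ∑ c ∈ codewords C₀, if M.mulVec c = v then (1 : ℝ) else 0 := by
    intro M v
    rw [hashFiber, sum_boole]
  have hs1 : ∀ M : Matrix (Fin m) (Fin n) (ZMod 2), ∑ v, (#(hashFiber C₀ M v) : ℝ) = K := by
    intro M
    simp_rw [hfib]
    rw [sum_comm]
    simp [hK]
  have hs2 : ∀ M : Matrix (Fin m) (Fin n) (ZMod 2), ∑ v, (#(hashFiber C₀ M v) : ℝ) ^ 2 =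
      ∑ c ∈ codewords C₀, ∑ c' ∈ codewords C₀,
        if M.mulVec c' = M.mulVec c then (1 : ℝ) else 0 := by
    intro M
    simp_rw [hfib, sq, sum_mul_sum]
    rw [sum_comm]
    refine sum_congr rfl fun c _ => ?_
    rw [sum_comm]
    refine sum_congr rfl fun c' _ => ?_
    simp [eq_comm]
  -- The squared sizes count colliding pairs of codewords, and distinct codewords collide with
  -- probability `1 / D`.
  have hs3 : W⁻¹ * ∑ M : Matrix (Fin m) (Fin n) (ZMod 2), ∑ v, (#(hashFiber C₀ M v) : ℝ) ^ 2 ≤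
      K * (K * D⁻¹ + 1) := by
    simp_rw [hs2]
    rw [sum_comm, mul_sum]
    simp_rw [sum_comm (s := univ) (t := codewords C₀), mul_sum]
    calc _ ≤ ∑ c ∈ codewords C₀, ∑ c' ∈ codewords C₀, (D⁻¹ + if c' = c then 1 else 0) := by
          refine sum_le_sum fun c _ => sum_le_sum fun c' _ => ?_
          rw [← mul_sum]
          exact collision c c'
      _ = _ := by
          simp [sum_add_distrib, mul_comm, mul_add, hK]
  calc _ ≤ W⁻¹ * ∑ M : Matrix (Fin m) (Fin n) (ZMod 2), D⁻¹ * ∑ v,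
        ((D / K) ^ 2 * (#(hashFiber C₀ M v) : ℝ) ^ 2 - 2 * (D / K) * #(hashFiber C₀ M v) + 1) := by
        gcongr with M _ v _
        exact hpt M v
    _ = D⁻¹ * (D / K) ^ 2 * (W⁻¹ * ∑ M : Matrix (Fin m) (Fin n) (ZMod 2),
          ∑ v, (#(hashFiber C₀ M v) : ℝ) ^ 2) - 1 := by
        simp_rw [sum_add_distrib, sum_sub_distrib, ← mul_sum, hs1]
        have hcV : ∑ _v : Bits m, (1 : ℝ) = D := by simp [hD, ZMod.card]
        rw [hcV, sum_add_distrib, sum_sub_distrib, ← mul_sum, sum_const, sum_const,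
          card_univ, nsmul_eq_mul, nsmul_eq_mul, ← hW]
        field_simp
        ring
    _ ≤ D⁻¹ * (D / K) ^ 2 * (K * (K * D⁻¹ + 1)) - 1 := by gcongr
    _ = D / K := by field_simp; ring

/-! ### Privacy amplification for a noisy codeword -/

/-- The mass of Alice's message `o` for the secret `v` when her codeword is added to a noise
distributed according to the mass function `g`. -/
def mixMass {n m : ℕ} (C₀ : Submodule (ZMod 2) (Bits n)) (g : Bits n → ℝ)
    (M : Matrix (Fin m) (Fin n) (ZMod 2)) (v : Bits m) (o : Option (Bits n)) : ℝ :=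
  ∑ r, g r * (((pickCodeword C₀ M v).map (Option.map fun c => c + r)) o).toReal

theorem mixMass_some {n m : ℕ} (C₀ : Submodule (ZMod 2) (Bits n)) (g : Bits n → ℝ)
    (M : Matrix (Fin m) (Fin n) (ZMod 2)) (v : Bits m) (y : Bits n) :
    mixMass C₀ g M v (some y) = ∑ c, (pickCodeword C₀ M v (some c)).toReal * g (y - c) := by
  unfold mixMass
  simp_rw [toReal_map, Fintype.sum_option, mul_add, mul_sum]
  simp only [Option.map_none, Option.map_some, reduceCtorEq, if_false, mul_zero, zero_add,
    Option.some.injEq]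
  rw [sum_comm]
  refine sum_congr rfl fun c _ => ?_
  rw [sum_eq_single (y - c)]
  · simp [mul_comm]
  · intro r _ hr
    rw [if_neg, mul_zero]
    rintro rfl
    simp at hr
  · simp

theorem mixMass_none {n m : ℕ} (C₀ : Submodule (ZMod 2) (Bits n)) (g : Bits n → ℝ)
    (M : Matrix (Fin m) (Fin n) (ZMod 2)) (v : Bits m) :
    mixMass C₀ g M v none = (pickCodeword C₀ M v none).toReal * ∑ r, g r := by
  unfold mixMass
  simp_rw [toReal_map, Fintype.sum_option]
  simp [← sum_mul, mul_comm]

theorem mixMass_nonneg {n m : ℕ} (C₀ : Submodule (ZMod 2) (Bits n)) {g : Bits n → ℝ}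
    (hg : ∀ r, 0 ≤ g r) (M : Matrix (Fin m) (Fin n) (ZMod 2)) (v : Bits m) (o : Option (Bits n)) :
    0 ≤ mixMass C₀ g M v o :=
  sum_nonneg fun r _ => mul_nonneg (hg r) ENNReal.toReal_nonneg

theorem sum_mixMass {n m : ℕ} (C₀ : Submodule (ZMod 2) (Bits n)) (g : Bits n → ℝ)
    (M : Matrix (Fin m) (Fin n) (ZMod 2)) (v : Bits m) :
    ∑ o, mixMass C₀ g M v o = ∑ r, g r := by
  unfold mixMass
  rw [sum_comm]
  refine sum_congr rfl fun r _ => ?_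
  rw [← mul_sum, sum_toReal, mul_one]

/-- The reference mass of a noisy codeword: a uniform codeword plus noise, smoothed. -/
def smoothMass {n : ℕ} (C₀ : Submodule (ZMod 2) (Bits n)) (g : Bits n → ℝ) (η : ℝ)
    (y : Bits n) : ℝ :=
  (#(codewords C₀) : ℝ)⁻¹ * (∑ c ∈ codewords C₀, g (y - c)) + η * (2 ^ n)⁻¹ * ∑ r, g r

/-- The reference mass of Alice's message. -/
def refMass {n : ℕ} (C₀ : Submodule (ZMod 2) (Bits n)) (g : Bits n → ℝ) (η : ℝ) :
    Option (Bits n) → ℝ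
  | none => η * (∑ r, g r) / (1 + 2 * η)
  | some y => smoothMass C₀ g η y / (1 + 2 * η)

/-- The codeword part, the uniform part and the value `none` weigh `1`, `η` and `η` times the mass
of `g`, whence the normalisation `1 + 2 * η`. -/
theorem sum_refMass {n : ℕ} (C₀ : Submodule (ZMod 2) (Bits n)) (g : Bits n → ℝ) {η : ℝ}
    (hη : 0 < η) : ∑ o, refMass C₀ g η o = ∑ r, g r := by
  rw [Fintype.sum_option]
  simp only [refMass, smoothMass]
  rw [← sum_div, sum_add_distrib, ← mul_sum, sum_comm]
  have h : ∀ c, ∑ y, g (y - c) = ∑ r, g r := fun c => (Equiv.subRight c).sum_comp g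
  have hK := card_codewords_pos C₀
  have hn : Fintype.card (Bits n) = 2 ^ n := by simp [ZMod.card]
  simp_rw [h, sum_const, card_univ, hn, nsmul_eq_mul]
  push_cast
  field_simp
  ring

theorem refMass_nonneg {n : ℕ} (C₀ : Submodule (ZMod 2) (Bits n)) {g : Bits n → ℝ} {η : ℝ}
    (hη : 0 < η) (hg : ∀ r, 0 ≤ g r) (o : Option (Bits n)) : 0 ≤ refMass C₀ g η o := by
  have h1 : 0 ≤ ∑ r, g r := sum_nonneg fun r _ => hg r
  have h2 : ∀ y, 0 ≤ ∑ c ∈ codewords C₀, g (y - c) := fun y => sum_nonneg fun r _ => hg _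
  cases o with
  | none => simp only [refMass]; positivity
  | some y =>
    have := h2 y
    simp only [refMass, smoothMass]; positivity

theorem le_smoothMass {n : ℕ} (C₀ : Submodule (ZMod 2) (Bits n)) {g : Bits n → ℝ} (η : ℝ)
    (hg : ∀ r, 0 ≤ g r) (y : Bits n) : η * (2 ^ n)⁻¹ * ∑ r, g r ≤ smoothMass C₀ g η y := by
  have h2 : 0 ≤ ∑ c ∈ codewords C₀, g (y - c) := sum_nonneg fun r _ => hg _
  unfold smoothMass
  have : 0 ≤ (#(codewords C₀) : ℝ)⁻¹ * ∑ c ∈ codewords C₀, g (y - c) := by positivity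
  linarith

theorem refMass_pos {n : ℕ} (C₀ : Submodule (ZMod 2) (Bits n)) {g : Bits n → ℝ} {η : ℝ}
    (hη : 0 < η) (hg : ∀ r, 0 ≤ g r) (hP : 0 < ∑ r, g r) (o : Option (Bits n)) :
    0 < refMass C₀ g η o := by
  cases o with
  | none => simp only [refMass]; positivity
  | some y =>
    have h := le_smoothMass C₀ η hg y
    have : 0 < smoothMass C₀ g η y := lt_of_lt_of_le (by positivity) h
    simp only [refMass]; positivity

/-- The excess of a noisy codeword over the smooth reference. -/
def excess {n : ℕ} (C₀ : Submodule (ZMod 2) (Bits n)) (m : ℕ) (g : Bits n → ℝ) (η : ℝ)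
    (e : Bits n) : ℝ :=
  2 ^ m * 2 ^ n / (#(codewords C₀) * η) * (g e / ∑ r, g r)

theorem excess_nonneg {n : ℕ} (C₀ : Submodule (ZMod 2) (Bits n)) (m : ℕ) {g : Bits n → ℝ}
    {η : ℝ} (hη : 0 < η) (hg : ∀ r, 0 ≤ g r) (e : Bits n) : 0 ≤ excess C₀ m g η e := by
  have h1 : 0 ≤ ∑ r, g r := sum_nonneg fun r _ => hg r
  have := hg e
  unfold excess
  positivity

/-- The mass, up to normalisation, of the noisy codewords with a given hash value. -/
def hashMass {n m : ℕ} (C₀ : Submodule (ZMod 2) (Bits n)) (g : Bits n → ℝ)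
    (M : Matrix (Fin m) (Fin n) (ZMod 2)) (v : Bits m) (y : Bits n) : ℝ :=
  2 ^ m / #(codewords C₀) *
    ∑ c ∈ codewords C₀, if M.mulVec c = v then g (y - c) else 0

/-- The fibre size in the denominator depends on `M`. Replacing it by its lower bound leaves an
expression linear in the hash indicators, which can be averaged over `M`. -/
theorem mixMass_le_hashMass {n m : ℕ} (C₀ : Submodule (ZMod 2) (Bits n)) {g : Bits n → ℝ}
    (hg : ∀ r, 0 ≤ g r) (M : Matrix (Fin m) (Fin n) (ZMod 2)) (v : Bits m) (y : Bits n) :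
    mixMass C₀ g M v (some y) ≤ hashMass C₀ g M v y := by
  rw [mixMass_some, hashMass, mul_sum, ← sum_subset (subset_univ (codewords C₀))]
  · refine sum_le_sum fun c hc => ?_
    have h := pickCodeword_mulVec_le C₀ M c v
    by_cases h1 : M.mulVec c = v
    · rw [if_pos ⟨hc, h1⟩] at h
      rw [if_pos h1]
      refine mul_le_mul_of_nonneg_right ?_ (hg _)
      rw [inv_mul_le_iff₀ (by positivity)] at h
      simpa [div_eq_mul_inv] using h
    · rw [if_neg (by tauto)] at h
      have h0 : (pickCodeword C₀ M v (some c)).toReal ≤ 0 := by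
        rw [inv_mul_le_iff₀ (by positivity)] at h
        simpa using h
      simp [h1, le_antisymm h0 ENNReal.toReal_nonneg]
  · intro c _ hc
    rw [pickCodeword_some, if_neg, zero_mul]
    simp [hashFiber, hc]

/-- When `c` is sent, every other codeword shares its hash value with probability `2 ^ (-m)`, and
these terms build the reference. Only `c` itself collides surely; its term is paid for by the
uniform part of the reference, and `excess` is the price. -/
theorem avg_hashMass_le {n m : ℕ} (C₀ : Submodule (ZMod 2) (Bits n)) {g : Bits n → ℝ}
    {η : ℝ} (hη : 0 < η) (hg : ∀ r, 0 ≤ g r) (hP : 0 < ∑ r, g r) {c : Bits n}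
    (hc : c ∈ codewords C₀) (y : Bits n) :
    (Fintype.card (Matrix (Fin m) (Fin n) (ZMod 2)) : ℝ)⁻¹ *
      ∑ M : Matrix (Fin m) (Fin n) (ZMod 2), hashMass C₀ g M (M.mulVec c) y ≤
      smoothMass C₀ g η y * (1 + excess C₀ m g η (y - c)) := by
  set W : ℝ := (Fintype.card (Matrix (Fin m) (Fin n) (ZMod 2)) : ℝ) with hW
  set P := ∑ r, g r with hPdef
  have hK := card_codewords_pos C₀
  have h1 : W⁻¹ * ∑ M : Matrix (Fin m) (Fin n) (ZMod 2), hashMass C₀ g M (M.mulVec c) y =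
      2 ^ m / #(codewords C₀) * ∑ c' ∈ codewords C₀, g (y - c') *
        (W⁻¹ * ∑ M : Matrix (Fin m) (Fin n) (ZMod 2),
          if M.mulVec c' = M.mulVec c then (1 : ℝ) else 0) := by
    unfold hashMass
    rw [← mul_sum, sum_comm, mul_left_comm, mul_sum]
    congr 1
    refine sum_congr rfl fun c' _ => ?_
    rw [mul_left_comm]
    congr 1
    rw [mul_sum]
    simp
  rw [h1]
  calc _ ≤ 2 ^ m / #(codewords C₀) * ∑ c' ∈ codewords C₀, g (y - c') *
        (((2 : ℝ) ^ m)⁻¹ + if c' = c then 1 else 0) := by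
        refine mul_le_mul_of_nonneg_left (sum_le_sum fun c' _ => ?_) (by positivity)
        exact mul_le_mul_of_nonneg_left (collision c c') (hg _)
    _ = (#(codewords C₀) : ℝ)⁻¹ * (∑ c' ∈ codewords C₀, g (y - c')) +
          2 ^ m / #(codewords C₀) * g (y - c) := by
        simp_rw [mul_add, sum_add_distrib, mul_ite, mul_one, mul_zero]
        rw [sum_ite_eq' , if_pos hc, ← sum_mul]
        field_simp
    _ ≤ smoothMass C₀ g η y + (η * (2 ^ n)⁻¹ * P) * excess C₀ m g η (y - c) := by
        have hx : (η * (2 ^ n)⁻¹ * P) * excess C₀ m g η (y - c) =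
            2 ^ m / #(codewords C₀) * g (y - c) := by
          unfold excess
          rw [← hPdef]
          field_simp
        rw [hx]
        have : 0 ≤ η * (2 ^ n)⁻¹ * P := by positivity
        unfold smoothMass
        linarith
    _ ≤ _ := by
        rw [mul_add, mul_one]
        have := mul_le_mul_of_nonneg_right (le_smoothMass C₀ η hg y)
          (excess_nonneg C₀ m hη hg (y - c))
        linarith

/-- Jensen's inequality in linear form: `log X ≤ log τ + X / τ - 1` for the ratio `X` to
`smoothMass` and `τ = 1 + excess`, so that the hash enters linearly and can be averaged later. The
message `none` costs `log η⁻¹` beyond the normalisation. -/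
theorem mixMass_mul_log_le {n m : ℕ} (C₀ : Submodule (ZMod 2) (Bits n)) {g : Bits n → ℝ}
    {η : ℝ} (hη : 0 < η) (hg : ∀ r, 0 ≤ g r) (hP : 0 < ∑ r, g r)
    (M : Matrix (Fin m) (Fin n) (ZMod 2)) (v : Bits m) :
    ∑ o, mixMass C₀ g M v o * Real.log (mixMass C₀ g M v o / refMass C₀ g η o) ≤
      (∑ r, g r) * (Real.log (1 + 2 * η) - 1 +
        (pickCodeword C₀ M v none).toReal * (1 + Real.log η⁻¹)) +
      ∑ c, (pickCodeword C₀ M v (some c)).toReal * ∑ y, g (y - c) *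
        (hashMass C₀ g M v y / (smoothMass C₀ g η y * (1 + excess C₀ m g η (y - c))) +
          Real.log (1 + excess C₀ m g η (y - c))) := by
  set P := ∑ r, g r with hPdef
  set p := (pickCodeword C₀ M v none).toReal with hp
  have hpv : p = 0 ∨ p = 1 := by
    rw [hp, pickCodeword_none]; split_ifs <;> simp
  have hη1 : (0 : ℝ) < 1 + 2 * η := by positivity
  rw [Fintype.sum_option]
  have hnone : mixMass C₀ g M v none *
      Real.log (mixMass C₀ g M v none / refMass C₀ g η none) =
      p * P * (Real.log (1 + 2 * η) + Real.log η⁻¹) := by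
    rw [mixMass_none, ← hPdef, ← hp]
    rcases hpv with h | h
    · simp [h]
    · rw [h, one_mul]
      congr 1
      rw [← Real.log_mul (by positivity) (by positivity)]
      congr 1
      simp only [refMass]
      rw [← hPdef]
      field_simp
  have hsome : ∀ y, mixMass C₀ g M v (some y) *
      Real.log (mixMass C₀ g M v (some y) / refMass C₀ g η (some y)) ≤
      ∑ c, (pickCodeword C₀ M v (some c)).toReal * (g (y - c) *
        (Real.log (1 + 2 * η) - 1 +
        (hashMass C₀ g M v y / (smoothMass C₀ g η y * (1 + excess C₀ m g η (y - c))) +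
          Real.log (1 + excess C₀ m g η (y - c))))) := by
    intro y
    have hm0 := mixMass_nonneg C₀ hg M v (some y)
    set L := Real.log (mixMass C₀ g M v (some y) / refMass C₀ g η (some y)) with hL
    rw [mixMass_some, sum_mul]
    refine sum_le_sum fun c _ => ?_
    rw [mul_assoc]
    have hw : 0 ≤ (pickCodeword C₀ M v (some c)).toReal := ENNReal.toReal_nonneg
    rcases eq_or_ne ((pickCodeword C₀ M v (some c)).toReal * g (y - c)) 0 with h0 | h0
    · rw [← mul_assoc, ← mul_assoc, h0, zero_mul, zero_mul]
    · refine mul_le_mul_of_nonneg_left (mul_le_mul_of_nonneg_left ?_ (hg _)) hw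
      have hmp : 0 < mixMass C₀ g M v (some y) := by
        rw [mixMass_some]
        refine lt_of_lt_of_le (lt_of_le_of_ne (mul_nonneg hw (hg _)) (Ne.symm h0))
          (single_le_sum (f := fun c => (pickCodeword C₀ M v (some c)).toReal * g (y - c))
            (fun c _ => mul_nonneg ENNReal.toReal_nonneg (hg _)) (mem_univ c))
      have hS : 0 < smoothMass C₀ g η y :=
        lt_of_lt_of_le (by positivity) (le_smoothMass C₀ η hg y)
      have hτ : 0 < 1 + excess C₀ m g η (y - c) := by
        have := excess_nonneg C₀ m hη hg (y - c)
        linarith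
      have hT := mixMass_le_hashMass C₀ hg M v y
      set τ := 1 + excess C₀ m g η (y - c)
      set S := smoothMass C₀ g η y with hSdef
      set G := mixMass C₀ g M v (some y)
      set T := hashMass C₀ g M v y
      have e1 : L = Real.log (1 + 2 * η) + Real.log τ + Real.log (G / (S * τ)) := by
        rw [hL, ← Real.log_mul (by positivity) (by positivity),
          ← Real.log_mul (by positivity) (by positivity)]
        congr 1
        simp only [refMass]
        rw [← hSdef]
        field_simp
      have e2 : Real.log (G / (S * τ)) ≤ G / (S * τ) - 1 :=
        Real.log_le_sub_one_of_pos (by positivity)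
      have e3 : G / (S * τ) ≤ T / (S * τ) := by gcongr
      linarith
  have hw1 : ∑ c, (pickCodeword C₀ M v (some c)).toReal = 1 - p := sum_pickCodeword_some C₀ M v
  have hshift : ∀ c, ∑ y, g (y - c) = P := fun c => (Equiv.subRight c).sum_comp g
  calc _ ≤ p * P * (Real.log (1 + 2 * η) + Real.log η⁻¹) + ∑ y, ∑ c,
        (pickCodeword C₀ M v (some c)).toReal * (g (y - c) *
        (Real.log (1 + 2 * η) - 1 +
        (hashMass C₀ g M v y / (smoothMass C₀ g η y * (1 + excess C₀ m g η (y - c))) +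
          Real.log (1 + excess C₀ m g η (y - c))))) := by
        rw [hnone]
        exact add_le_add_right (sum_le_sum fun y _ => hsome y) _
    _ = p * P * (Real.log (1 + 2 * η) + Real.log η⁻¹) +
        (∑ c, (pickCodeword C₀ M v (some c)).toReal) * (P * (Real.log (1 + 2 * η) - 1)) +
        ∑ c, (pickCodeword C₀ M v (some c)).toReal * ∑ y, g (y - c) *
        (hashMass C₀ g M v y / (smoothMass C₀ g η y * (1 + excess C₀ m g η (y - c))) +
          Real.log (1 + excess C₀ m g η (y - c))) := by
        rw [sum_comm, add_assoc, sum_mul, ← sum_add_distrib]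
        congr 1
        refine sum_congr rfl fun c _ => ?_
        rw [← mul_sum, ← mul_add, ← hshift c, sum_mul, ← sum_add_distrib]
        simp_rw [mul_add]
    _ = _ := by
        rw [hw1]; ring

/-- The divergence of Alice's message from the reference, on average over the hashing matrix and
the secret. -/
theorem avg_mixMass_mul_log_le {n m : ℕ} (C₀ : Submodule (ZMod 2) (Bits n)) {g : Bits n → ℝ}
    {η : ℝ} (hη : 0 < η) (hη1 : η ≤ 1) (hg : ∀ r, 0 ≤ g r) :
    (Fintype.card (Matrix (Fin m) (Fin n) (ZMod 2)) : ℝ)⁻¹ *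
      ∑ M : Matrix (Fin m) (Fin n) (ZMod 2), ((2 : ℝ) ^ m)⁻¹ * ∑ v,
        ∑ o, mixMass C₀ g M v o * Real.log (mixMass C₀ g M v o / refMass C₀ g η o) ≤
      (∑ r, g r) * (2 * η + 2 ^ m / #(codewords C₀) * (1 + Real.log η⁻¹)) +
        ∑ e, g e * Real.log (1 + excess C₀ m g η e) := by
  rcases eq_or_lt_of_le (sum_nonneg fun r (_ : r ∈ univ) => hg r) with hP | hP
  · have h0 : ∀ r, g r = 0 := fun r =>
      (sum_eq_zero_iff_of_nonneg fun r _ => hg r).1 hP.symm r (mem_univ r)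
    simp [mixMass, h0]
  set P := ∑ r, g r with hPdef
  set W : ℝ := (Fintype.card (Matrix (Fin m) (Fin n) (ZMod 2)) : ℝ) with hW
  have hWp : 0 < W := by rw [hW]; exact_mod_cast Fintype.card_pos
  set K : ℝ := (#(codewords C₀) : ℝ) with hK
  have hKp : 0 < K := card_codewords_pos C₀
  set τ : Bits n → ℝ := fun e => 1 + excess C₀ m g η e with hτ
  have hτ1 : ∀ e, 1 ≤ τ e := fun e => by
    have := excess_nonneg C₀ m hη hg e
    simp only [hτ]; linarith
  have hS : ∀ y, 0 < smoothMass C₀ g η y := fun y =>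
    lt_of_lt_of_le (by positivity) (le_smoothMass C₀ η hg y)
  have hT : ∀ (M : Matrix (Fin m) (Fin n) (ZMod 2)) v y, 0 ≤ hashMass C₀ g M v y := by
    intro M v y
    exact (mixMass_nonneg C₀ hg M v _).trans (mixMass_le_hashMass C₀ hg M v y)
  set F : Matrix (Fin m) (Fin n) (ZMod 2) → Bits m → Bits n → ℝ := fun M v c =>
    ∑ y, g (y - c) * (hashMass C₀ g M v y / (smoothMass C₀ g η y * τ (y - c)) +
      Real.log (τ (y - c))) with hF
  have hF0 : ∀ M v c, 0 ≤ F M v c := fun M v c => sum_nonneg fun y _ => mul_nonneg (hg _)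
    (add_nonneg (div_nonneg (hT M v y) (mul_nonneg (hS y).le (by linarith [hτ1 (y - c)])))
      (Real.log_nonneg (hτ1 _)))
  have hshift : ∀ (c : Bits n) (f : Bits n → ℝ), ∑ y, f (y - c) = ∑ r, f r :=
    fun c f => (Equiv.subRight c).sum_comp f
  -- the average over the secret and the codeword
  have hcode : ∀ M : Matrix (Fin m) (Fin n) (ZMod 2), ((2 : ℝ) ^ m)⁻¹ * ∑ v, ∑ c,
      (pickCodeword C₀ M v (some c)).toReal * F M v c ≤
        K⁻¹ * ∑ c ∈ codewords C₀, F M (M.mulVec c) c := by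
    intro M
    rw [sum_comm, mul_sum, mul_sum, ← sum_subset (subset_univ (codewords C₀))]
    · refine sum_le_sum fun c hc => ?_
      rw [mul_sum]
      calc _ ≤ ∑ v, (if M.mulVec c = v then K⁻¹ * F M v c else 0) := by
            refine sum_le_sum fun v _ => ?_
            have h := mul_le_mul_of_nonneg_right (pickCodeword_mulVec_le C₀ M c v) (hF0 M v c)
            rw [← mul_assoc]
            refine h.trans (le_of_eq ?_)
            simp [hc, hK]
        _ = _ := by simp
    · intro c _ hc
      refine mul_eq_zero_of_right _ (sum_eq_zero fun v _ => ?_)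
      rw [pickCodeword_some, if_neg, zero_mul]
      simp [hashFiber, hc]
  -- By `avg_hashMass_le` the quotient inside `F` averages to at most `1`; the resulting `P` cancels
  -- the `-1` of the linearised logarithm.
  have havg : W⁻¹ * ∑ M, K⁻¹ * ∑ c ∈ codewords C₀, F M (M.mulVec c) c ≤
      P + ∑ e, g e * Real.log (τ e) := by
    have h1 : ∀ c ∈ codewords C₀, W⁻¹ * ∑ M : Matrix (Fin m) (Fin n) (ZMod 2),
        F M (M.mulVec c) c ≤ P + ∑ e, g e * Real.log (τ e) := by
      intro c hc
      rw [hF, sum_comm, mul_sum, ← hshift c (fun e => g e * Real.log (τ e)), hPdef,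
        ← hshift c g, ← sum_add_distrib]
      refine sum_le_sum fun y _ => ?_
      have h2 := avg_hashMass_le (m := m) C₀ hη hg hP hc y
      rw [← mul_sum, sum_add_distrib, ← sum_div, sum_const, card_univ, nsmul_eq_mul, ← hW,
        mul_left_comm, ← mul_one_add]
      refine mul_le_mul_of_nonneg_left ?_ (hg _)
      rw [mul_add, inv_mul_cancel_left₀ hWp.ne', ← mul_div_assoc]
      have hpos : 0 < smoothMass C₀ g η y * τ (y - c) :=
        mul_pos (hS y) (by linarith [hτ1 (y - c)])
      exact add_le_add_left ((div_le_one hpos).2 h2) _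
    rw [← mul_sum, sum_comm, mul_left_comm, mul_sum]
    calc _ ≤ K⁻¹ * ∑ c ∈ codewords C₀, (P + ∑ e, g e * Real.log (τ e)) := by
          gcongr with c hc
          exact h1 c hc
      _ = _ := by
          rw [sum_const, nsmul_eq_mul, ← hK, inv_mul_cancel_left₀ hKp.ne']
  have hlogη : 0 ≤ Real.log η⁻¹ := Real.log_nonneg ((one_le_inv₀ hη).2 hη1)
  have hlog2 : Real.log (1 + 2 * η) ≤ 2 * η := by
    have := Real.log_le_sub_one_of_pos (by positivity : (0 : ℝ) < 1 + 2 * η)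
    linarith
  calc _ ≤ W⁻¹ * ∑ M : Matrix (Fin m) (Fin n) (ZMod 2), ((2 : ℝ) ^ m)⁻¹ * ∑ v,
        (P * (Real.log (1 + 2 * η) - 1 +
          (pickCodeword C₀ M v none).toReal * (1 + Real.log η⁻¹)) +
        ∑ c, (pickCodeword C₀ M v (some c)).toReal * F M v c) := by
        gcongr with M _ v _
        exact mixMass_mul_log_le C₀ hη hg hP M v
    _ = P * (Real.log (1 + 2 * η) - 1) + P * (1 + Real.log η⁻¹) *
          (W⁻¹ * ∑ M : Matrix (Fin m) (Fin n) (ZMod 2), ((2 : ℝ) ^ m)⁻¹ *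
            ∑ v, (pickCodeword C₀ M v none).toReal) +
        W⁻¹ * ∑ M : Matrix (Fin m) (Fin n) (ZMod 2), (((2 : ℝ) ^ m)⁻¹ * ∑ v, ∑ c,
          (pickCodeword C₀ M v (some c)).toReal * F M v c) := by
        have hM : ∀ M : Matrix (Fin m) (Fin n) (ZMod 2), ((2 : ℝ) ^ m)⁻¹ * ∑ v,
            (P * (Real.log (1 + 2 * η) - 1 +
              (pickCodeword C₀ M v none).toReal * (1 + Real.log η⁻¹)) +
            ∑ c, (pickCodeword C₀ M v (some c)).toReal * F M v c) =
            P * (Real.log (1 + 2 * η) - 1) + P * (1 + Real.log η⁻¹) *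
              (((2 : ℝ) ^ m)⁻¹ * ∑ v, (pickCodeword C₀ M v none).toReal) +
            ((2 : ℝ) ^ m)⁻¹ * ∑ v, ∑ c, (pickCodeword C₀ M v (some c)).toReal * F M v c := by
          intro M
          have hV' : (Fintype.card (Bits m) : ℝ) = 2 ^ m := by simp [ZMod.card]
          rw [sum_add_distrib, ← mul_sum, sum_add_distrib, ← sum_mul, sum_const, card_univ,
            nsmul_eq_mul, hV']
          field_simp
        simp_rw [hM]
        rw [sum_add_distrib, sum_add_distrib, sum_const, card_univ, nsmul_eq_mul, ← hW, ← mul_sum]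
        field_simp
    _ ≤ P * (2 * η - 1) + P * (1 + Real.log η⁻¹) * (2 ^ m / K) +
        (P + ∑ e, g e * Real.log (τ e)) := by
        gcongr
        · exact avg_pickCodeword_none_le C₀
        · refine le_trans ?_ havg
          exact mul_le_mul_of_nonneg_left (sum_le_sum fun M _ => hcode M) (by positivity)
    _ = _ := by ring

/-! ### The noise seen through a duplicated bit -/

theorem zmod_two_cases : ∀ a : ZMod 2, a = 0 ∨ a = 1 := by decide

theorem zmod_two_one_add_one : (1 : ZMod 2) + 1 = 0 := by decide

theorem sum_zmod_two (f : ZMod 2 → ℝ) : ∑ b, f b = f 0 + f 1 := Fin.sum_univ_two f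

theorem sum_zmod_two' (f : ZMod 2 → ℝ) (a : ZMod 2) : ∑ b, f b = f (a + 1) + f a := by
  rw [sum_zmod_two]
  rcases zmod_two_cases a with rfl | rfl
  · rw [zero_add, add_comm]
  · rw [zmod_two_one_add_one]

/-- The mass of the pair `z` received when a uniform bit is sent twice. -/
def recvMass (φ : unitInterval) (z : ZMod 2 × ZMod 2) : ℝ := ∑ b, pairMass φ b z

theorem toReal_bsc (φ : unitInterval) (a b : ZMod 2) :
    (bsc φ a b).toReal = if b = a then 1 - (φ : ℝ) else φ := by
  have h0 : (0 : ℝ) ≤ φ := φ.2.1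
  have h1 : (0 : ℝ) ≤ 1 - φ := sub_nonneg.2 φ.2.2
  unfold bsc
  rw [toReal_map]
  simp only [PMF.ofFintype_apply]
  rw [sum_zmod_two]
  rcases zmod_two_cases a with rfl | rfl <;> rcases zmod_two_cases b with rfl | rfl <;>
    simp [h0, h1, zmod_two_one_add_one]

theorem pairMass_nonneg (φ : unitInterval) (b : ZMod 2) (z : ZMod 2 × ZMod 2) :
    0 ≤ pairMass φ b z := by
  unfold pairMass
  have := @ENNReal.toReal_nonneg
  exact mul_nonneg (by norm_num) (mul_nonneg this this)

theorem recvMass_nonneg (φ : unitInterval) (z : ZMod 2 × ZMod 2) : 0 ≤ recvMass φ z :=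
  sum_nonneg fun b _ => pairMass_nonneg φ b z

theorem blockMass_nonneg (φ : unitInterval) {k : ℕ} (r : Bits k) (z : Fin k → ZMod 2 × ZMod 2) :
    0 ≤ blockMass φ r z :=
  prod_nonneg fun j _ => pairMass_nonneg φ (r j) (z j)

theorem sum_blockMass (φ : unitInterval) {k : ℕ} (z : Fin k → ZMod 2 × ZMod 2) :
    ∑ r, blockMass φ r z = ∏ j, recvMass φ (z j) :=
  (Fintype.prod_sum fun j b => pairMass φ b (z j)).symm

theorem recvMass_eq (φ : unitInterval) (z : ZMod 2 × ZMod 2) :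
    recvMass φ z = if z.1 ≠ z.2 then erasureProb φ / 2 else (1 - erasureProb φ) / 2 := by
  obtain ⟨a, b⟩ := z
  unfold recvMass pairMass erasureProb
  simp only [toReal_bsc]
  rw [sum_zmod_two]
  rcases zmod_two_cases a with rfl | rfl <;> rcases zmod_two_cases b with rfl | rfl <;>
    simp <;> ring

theorem sum_recvMass_mul (φ : unitInterval) (σ : ℝ) :
    ∑ z : ZMod 2 × ZMod 2, recvMass φ z * (if z.1 ≠ z.2 then 1 else σ) =
      erasureProb φ + (1 - erasureProb φ) * σ := by
  simp_rw [recvMass_eq]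
  rw [Fintype.sum_prod_type]
  simp only [sum_zmod_two]
  simp
  ring

/-- The crossover probability of a pair that is not erased. -/
def condCross (φ : unitInterval) : ℝ := (φ : ℝ) ^ 2 / (1 - erasureProb φ)

theorem one_sub_erasureProb (φ : unitInterval) :
    1 - erasureProb φ = (φ : ℝ) ^ 2 + (1 - φ) ^ 2 := by unfold erasureProb; ring

theorem one_sub_erasureProb_pos (φ : unitInterval) : 0 < 1 - erasureProb φ := by
  rw [one_sub_erasureProb]
  nlinarith [sq_nonneg ((φ : ℝ) - (1 - φ))]

theorem erasureProb_nonneg (φ : unitInterval) : 0 ≤ erasureProb φ :=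
  mul_nonneg (mul_nonneg zero_le_two φ.2.1) (sub_nonneg.2 φ.2.2)

theorem one_sub_condCross (φ : unitInterval) :
    1 - condCross φ = (1 - (φ : ℝ)) ^ 2 / (1 - erasureProb φ) := by
  have := one_sub_erasureProb_pos φ
  unfold condCross
  rw [eq_div_iff this.ne', sub_mul, div_mul_cancel₀ _ this.ne']
  unfold erasureProb
  ring

theorem condCross_nonneg (φ : unitInterval) : 0 ≤ condCross φ :=
  div_nonneg (sq_nonneg _) (one_sub_erasureProb_pos φ).le

theorem condCross_le_one (φ : unitInterval) : condCross φ ≤ 1 := by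
  have := one_sub_condCross φ
  have h2 : 0 ≤ (1 - (φ : ℝ)) ^ 2 / (1 - erasureProb φ) :=
    div_nonneg (sq_nonneg _) (one_sub_erasureProb_pos φ).le
  linarith

/-- The generating function of the noise on a pair that is not erased. -/
def noiseGen (φ : unitInterval) (s : ℝ) : ℝ :=
  2 ^ s * (condCross φ * condCross φ ^ s + (1 - condCross φ) * (1 - condCross φ) ^ s)

/-- An erased pair leaves the bit uniform, so the base of the power is `1`. Otherwise the bit
differs from the common received value with posterior probability `condCross φ`. -/
theorem sum_pairMass_rpow (φ : unitInterval) (s : ℝ) (z : ZMod 2 × ZMod 2) :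
    ∑ b, pairMass φ b z * (2 * (pairMass φ b z / recvMass φ z)) ^ s =
      recvMass φ z * if z.1 ≠ z.2 then 1 else noiseGen φ s := by
  have hp := one_sub_erasureProb_pos φ
  have hq1 := sub_nonneg.2 (condCross_le_one φ)
  have hq0 := condCross_nonneg φ
  split_ifs with h
  · have hb : ∀ b, pairMass φ b z = recvMass φ z / 2 := by
      intro b
      rw [recvMass_eq, if_pos h]
      obtain ⟨z1, z2⟩ := z
      simp only [pairMass, toReal_bsc, erasureProb]
      revert h
      rcases zmod_two_cases b with rfl | rfl <;> rcases zmod_two_cases z1 with rfl | rfl <;>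
        rcases zmod_two_cases z2 with rfl | rfl <;> simp <;> ring
    simp_rw [hb]
    rcases eq_or_ne (recvMass φ z) 0 with h0 | h0
    · simp [h0]
    · rw [show 2 * (recvMass φ z / 2 / recvMass φ z) = 1 by field_simp]
      simp [ZMod.card]
      ring
  · push Not at h
    obtain ⟨z1, z2⟩ := z
    simp only at h
    subst h
    have hr : recvMass φ (z1, z1) = (1 - erasureProb φ) / 2 := by rw [recvMass_eq]; simp
    have e1 : pairMass φ (z1 + 1) (z1, z1) / recvMass φ (z1, z1) = condCross φ := by
      rw [hr]
      simp only [pairMass, toReal_bsc, condCross]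
      rw [if_neg (by simp)]
      field_simp
    have e2 : pairMass φ z1 (z1, z1) / recvMass φ (z1, z1) = 1 - condCross φ := by
      rw [hr, one_sub_condCross]
      simp only [pairMass, toReal_bsc, if_true]
      field_simp
    have hrp : recvMass φ (z1, z1) ≠ 0 := by rw [hr]; positivity
    have e1' : pairMass φ (z1 + 1) (z1, z1) = condCross φ * recvMass φ (z1, z1) := by
      rw [← e1]; field_simp
    have e2' : pairMass φ z1 (z1, z1) = (1 - condCross φ) * recvMass φ (z1, z1) := by
      rw [← e2]; field_simp
    rw [sum_zmod_two' _ z1, e1, e2, e1', e2', Real.mul_rpow two_pos.le hq0, Real.mul_rpow two_pos.le hq1,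
      noiseGen]
    ring

/-- Subadditivity of `x ^ s`, with `log t ≤ t - 1` at `t = (1 + x) ^ s`. Unlike the logarithm, a
power factorises over positions. -/
theorem log_one_add_le_rpow {x s : ℝ} (hx : 0 ≤ x) (hs : 0 < s) (hs1 : s ≤ 1) :
    Real.log (1 + x) ≤ s⁻¹ * x ^ s := by
  have h1 : (1 + x) ^ s ≤ 1 + x ^ s := by
    simpa using Real.rpow_add_le_add_rpow zero_le_one hx hs.le hs1
  have h2 : s * Real.log (1 + x) ≤ x ^ s := by
    rw [← Real.log_rpow (by positivity)]
    have := Real.log_le_sub_one_of_pos (by positivity : 0 < (1 + x) ^ s)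
    linarith
  rw [inv_mul_eq_div, le_div_iff₀ hs]
  linarith

theorem sum_blockMass_log_le (φ : unitInterval) {n m : ℕ} (C₀ : Submodule (ZMod 2) (Bits n))
    {η s : ℝ} (hη : 0 < η) (hs : 0 < s) (hs1 : s ≤ 1) (z : Fin n → ZMod 2 × ZMod 2) :
    ∑ e, blockMass φ e z * Real.log (1 + excess C₀ m (fun r => blockMass φ r z) η e) ≤
      s⁻¹ * (2 ^ m / (#(codewords C₀) * η)) ^ s *
        ∏ j, (recvMass φ (z j) * if (z j).1 ≠ (z j).2 then 1 else noiseGen φ s) := by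
  have hK := card_codewords_pos C₀
  simp_rw [← sum_pairMass_rpow]
  rw [Fintype.prod_sum, mul_sum]
  refine sum_le_sum fun e _ => ?_
  have h0 : ∀ j, 0 ≤ 2 * (pairMass φ (e j) (z j) / recvMass φ (z j)) := fun j =>
    mul_nonneg two_pos.le (div_nonneg (pairMass_nonneg _ _ _) (recvMass_nonneg _ _))
  have hx : excess C₀ m (fun r => blockMass φ r z) η e =
      2 ^ m / (#(codewords C₀) * η) * ∏ j, (2 * (pairMass φ (e j) (z j) / recvMass φ (z j))) := by
    rw [excess, sum_blockMass, blockMass, prod_mul_distrib, prod_const, prod_div_distrib,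
      card_univ, Fintype.card_fin]
    ring
  have h1 := log_one_add_le_rpow (excess_nonneg C₀ m hη (fun r => blockMass_nonneg φ r z) e) hs hs1
  refine (mul_le_mul_of_nonneg_left h1 (blockMass_nonneg φ e z)).trans (le_of_eq ?_)
  rw [hx, Real.mul_rpow (by positivity) (prod_nonneg fun j _ => h0 j),
    ← Real.finsetProd_rpow _ _ (fun j _ => h0 j), blockMass, prod_mul_distrib]
  ring

/-! ### The divergence of Bob's view from its reference -/

/-- Everything in Bob's view of `P₀` except Alice's messages. -/
abbrev Frame (n₀ : ℕ) :=
  Received n₀ × IndexSet n₀ × (Equiv.Perm (Fin n₀) × Equiv.Perm (Fin n₀))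

/-- The mass of the set chosen and of the permutations, given what was received. -/
def frameMass {n₀ : ℕ} (sel : Selection n₀) (t : Frame n₀) : ℝ :=
  (sel t.1 t.2.1).toReal * ((Fintype.card (Equiv.Perm (Fin n₀)) : ℝ)⁻¹) ^ 2

/-- The received block assigned to the wanted secret. -/
def wantedBlock {n₀ : ℕ} (t : Frame n₀) : Fin n₀ → ZMod 2 × ZMod 2 :=
  subBlock t.1 t.2.1 t.2.2.1

/-- The received block assigned to the other secret. -/
def otherBlock {n₀ : ℕ} (t : Frame n₀) : Fin n₀ → ZMod 2 × ZMod 2 :=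
  subBlock t.1 t.2.1.other t.2.2.2

/-- The mass on views, with the wanted secret in first position, obtained from masses `A` and `B` of
the messages for the wanted and for the other secret. -/
def viewMass {n₀ : ℕ} (sel : Selection n₀)
    (A B : (Fin n₀ → ZMod 2 × ZMod 2) → Option (Bits n₀) → ℝ) (o : View₀ n₀) : ℝ :=
  frameMass sel (o.1, o.2.1, o.2.2.1) *
    (A (wantedBlock (o.1, o.2.1, o.2.2.1)) o.2.2.2.1 *
      B (otherBlock (o.1, o.2.1, o.2.2.1)) o.2.2.2.2)

/-- Exchange of the roles of the two secrets in a view. -/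
def swapView (n₀ : ℕ) : View₀ n₀ ≃ View₀ n₀ :=
  (Equiv.refl _).prodCongr ((Equiv.refl _).prodCongr ((Equiv.prodComm _ _).prodCongr
    (Equiv.prodComm _ _)))

/-- The view with the secret that Bob asks for in first position. -/
def orientView {n₀ : ℕ} (a : ZMod 2) : View₀ n₀ ≃ View₀ n₀ :=
  if a = 0 then Equiv.refl _ else swapView n₀

theorem runP₀_eq_viewMass (φ : unitInterval) {n₀ m : ℕ} (C₀ : Submodule (ZMod 2) (Bits n₀))
    (sel : Selection n₀) (M : Matrix (Fin m) (Fin n₀) (ZMod 2)) (a : ZMod 2) (x y : Bits m)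
    (o : View₀ n₀) :
    (runP₀ φ C₀ sel M a x y o).toReal =
      viewMass sel (msgMass φ C₀ M (if a = 0 then x else y))
        (msgMass φ C₀ M (if a = 0 then y else x)) (orientView a o) := by
  rw [toReal_runP₀ φ C₀ sel M a x y o _ rfl]
  by_cases h : a = 0
  · simp only [h, if_true, orientView, Equiv.refl_apply]
    rfl
  · simp only [h, if_false, orientView, IndexSet.other_other]
    rw [mul_comm (msgMass φ C₀ M x _ _)]
    rfl

theorem sum_view {n₀ : ℕ} (f : View₀ n₀ → ℝ) :
    ∑ o, f o = ∑ t : Frame n₀, ∑ oo : Option (Bits n₀) × Option (Bits n₀),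
      f (t.1, t.2.1, t.2.2, oo) := by
  simp only [Fintype.sum_prod_type]

theorem sum_viewMass {n₀ : ℕ} (sel : Selection n₀)
    (A B : (Fin n₀ → ZMod 2 × ZMod 2) → Option (Bits n₀) → ℝ) :
    ∑ o, viewMass sel A B o = ∑ t : Frame n₀, frameMass sel t *
      ((∑ o, A (wantedBlock t) o) * ∑ o, B (otherBlock t) o) := by
  rw [sum_view]
  refine sum_congr rfl fun t _ => ?_
  rw [sum_mul_sum, ← Fintype.sum_prod_type', mul_sum]
  rfl

theorem frameMass_nonneg {n₀ : ℕ} (sel : Selection n₀) (t : Frame n₀) : 0 ≤ frameMass sel t :=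
  mul_nonneg ENNReal.toReal_nonneg (sq_nonneg _)

/-- Averaging over frames. -/
theorem sum_frameMass_mul {n₀ : ℕ} (sel : Selection n₀) (F : Received n₀ → ℝ) :
    ∑ t : Frame n₀, frameMass sel t * F t.1 = ∑ z, F z := by
  have hN : (Fintype.card (Equiv.Perm (Fin n₀)) : ℝ) ≠ 0 := by
    exact_mod_cast Fintype.card_ne_zero
  rw [Fintype.sum_prod_type]
  refine sum_congr rfl fun z _ => ?_
  change ∑ y, frameMass sel (z, y) * F z = F z
  rw [← sum_mul, Fintype.sum_prod_type]
  simp only [frameMass]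
  simp_rw [sum_const, card_univ, Fintype.card_prod, nsmul_eq_mul]
  rw [← mul_sum, ← sum_mul, sum_toReal]
  push_cast
  field_simp

theorem prod_wanted_mul_prod_other {n₀ : ℕ} (t : Frame n₀) (f : ZMod 2 × ZMod 2 → ℝ) :
    (∏ j, f (wantedBlock t j)) * ∏ j, f (otherBlock t j) = ∏ i, f (t.1 i) :=
  (prod_split t.2.1 t.2.2.1 t.2.2.2 fun i => f (t.1 i)).symm

theorem prod_subBlock {n₀ : ℕ} {α : Type} (z : Fin (2 * n₀) → α) (I : IndexSet n₀)
    (π : Equiv.Perm (Fin n₀)) (f : α → ℝ) :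
    ∏ j, f (subBlock z I π j) = ∏ i ∈ I.1, f (z i) := by
  have h : ∏ j, f (subBlock z I π j) = ∏ j, f (z (I.1.orderEmbOfFin I.2 j)) :=
    Equiv.prod_comp π fun j => f (z (I.1.orderEmbOfFin I.2 j))
  rw [h, ← prod_image (s := univ) (f := fun i => f (z i))
    (g := I.1.orderEmbOfFin I.2) (fun i _ j _ hij => (I.1.orderEmbOfFin I.2).injective hij),
    image_orderEmbOfFin_univ]

/-- The erasure condition says that the other set holds at most half of all non-erased indices. So
`σ ^ 2` on those is dominated by `σ` on all non-erased indices, a bound in which `I` no longer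
appears. -/
theorem prod_noise_le {n₀ : ℕ} (t : Frame n₀)
    (ht : (t.2.1.1 ∩ erased t.1).card ≤ (t.2.1.other.1 ∩ erased t.1).card) {σ : ℝ} (hσ : 1 ≤ σ) :
    ∏ j, (if (otherBlock t j).1 ≠ (otherBlock t j).2 then 1 else σ ^ 2) ≤
      ∏ i, if (t.1 i).1 ≠ (t.1 i).2 then 1 else σ := by
  obtain ⟨z, I, π, π'⟩ := t
  change #(I.1 ∩ erased z) ≤ #(I.other.1 ∩ erased z) at ht
  change ∏ j, (fun p : ZMod 2 × ZMod 2 => if p.1 ≠ p.2 then (1 : ℝ) else σ ^ 2)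
    (subBlock z I.other π' j) ≤ ∏ i, if (z i).1 ≠ (z i).2 then 1 else σ
  rw [prod_subBlock z I.other π' fun p => if p.1 ≠ p.2 then 1 else σ ^ 2]
  simp only [prod_ite, prod_const_one, one_mul, prod_const]
  rw [← pow_mul]
  refine pow_le_pow_right₀ hσ ?_
  have h1 : #(I.other.1 ∩ erased z) + #{i ∈ I.other.1 | ¬(z i).1 ≠ (z i).2} = n₀ := by
    have : I.other.1 ∩ erased z = {i ∈ I.other.1 | (z i).1 ≠ (z i).2} := by
      ext; simp [erased]
    rw [this, card_filter_add_card_filter_not, I.other.2]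
  have h2 : #(erased z) + #{i | ¬(z i).1 ≠ (z i).2} = 2 * n₀ := by
    rw [erased, card_filter_add_card_filter_not, card_univ, Fintype.card_fin]
  have h3 : #(I.1 ∩ erased z) + #(I.other.1 ∩ erased z) = #(erased z) := by
    rw [← card_union_of_disjoint, ← union_inter_distrib_right]
    · simp [IndexSet.other]
    · refine disjoint_left.2 fun i hi hi' => ?_
      simp only [IndexSet.other, mem_inter, mem_compl] at hi hi'
      exact hi'.1 hi.1
  omega

theorem sum_prod_recvMass (φ : unitInterval) {k : ℕ} (σ : ℝ) :
    ∑ z : Fin k → ZMod 2 × ZMod 2,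
      ∏ i, (recvMass φ (z i) * if (z i).1 ≠ (z i).2 then 1 else σ) =
        (erasureProb φ + (1 - erasureProb φ) * σ) ^ k := by
  rw [← Fintype.prod_sum fun (_ : Fin k) (p : ZMod 2 × ZMod 2) =>
    recvMass φ p * if p.1 ≠ p.2 then 1 else σ]
  rw [prod_const, sum_recvMass_mul, card_univ, Fintype.card_fin]

theorem sum_prod_recvMass_one (φ : unitInterval) {k : ℕ} :
    ∑ z : Fin k → ZMod 2 × ZMod 2, ∏ i, recvMass φ (z i) = 1 := by
  have := sum_prod_recvMass φ (k := k) 1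
  simpa using this

theorem msgMass_eq_mixMass (φ : unitInterval) {n₀ m : ℕ} (C₀ : Submodule (ZMod 2) (Bits n₀))
    (M : Matrix (Fin m) (Fin n₀) (ZMod 2)) (v : Bits m) (z : Fin n₀ → ZMod 2 × ZMod 2)
    (o : Option (Bits n₀)) :
    msgMass φ C₀ M v z o = mixMass C₀ (fun r => blockMass φ r z) M v o := rfl

theorem sum_msgMass (φ : unitInterval) {n₀ m : ℕ} (C₀ : Submodule (ZMod 2) (Bits n₀))
    (M : Matrix (Fin m) (Fin n₀) (ZMod 2)) (v : Bits m) (z : Fin n₀ → ZMod 2 × ZMod 2) :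
    ∑ o, msgMass φ C₀ M v z o = ∏ j, recvMass φ (z j) := by
  simp_rw [msgMass_eq_mixMass]
  rw [sum_mixMass, sum_blockMass]

theorem msgMass_nonneg (φ : unitInterval) {n₀ m : ℕ} (C₀ : Submodule (ZMod 2) (Bits n₀))
    (M : Matrix (Fin m) (Fin n₀) (ZMod 2)) (v : Bits m) (z : Fin n₀ → ZMod 2 × ZMod 2)
    (o : Option (Bits n₀)) : 0 ≤ msgMass φ C₀ M v z o :=
  mixMass_nonneg C₀ (fun r => blockMass_nonneg φ r z) M v o

/-- The reference mass of Alice's message for the other secret. -/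
def msgRef (φ : unitInterval) {n₀ : ℕ} (C₀ : Submodule (ZMod 2) (Bits n₀)) (η : ℝ)
    (z : Fin n₀ → ZMod 2 × ZMod 2) (o : Option (Bits n₀)) : ℝ :=
  refMass C₀ (fun r => blockMass φ r z) η o

/-- The reference for Bob's view, given the wanted secret `w`. -/
def viewRef (φ : unitInterval) {n₀ m : ℕ} (C₀ : Submodule (ZMod 2) (Bits n₀))
    (sel : Selection n₀) (η : ℝ) (M : Matrix (Fin m) (Fin n₀) (ZMod 2)) (a : ZMod 2) (w : Bits m)
    (o : View₀ n₀) : ℝ :=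
  viewMass sel (msgMass φ C₀ M w) (msgRef φ C₀ η) (orientView a o)

theorem viewRef_nonneg (φ : unitInterval) {n₀ m : ℕ} (C₀ : Submodule (ZMod 2) (Bits n₀))
    (sel : Selection n₀) {η : ℝ} (hη : 0 < η) (M : Matrix (Fin m) (Fin n₀) (ZMod 2)) (a : ZMod 2)
    (w : Bits m) (o : View₀ n₀) : 0 ≤ viewRef φ C₀ sel η M a w o :=
  mul_nonneg (frameMass_nonneg _ _) (mul_nonneg (msgMass_nonneg ..)
    (refMass_nonneg C₀ hη (fun r => blockMass_nonneg φ r _) _))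

theorem sum_viewRef (φ : unitInterval) {n₀ m : ℕ} (C₀ : Submodule (ZMod 2) (Bits n₀))
    (sel : Selection n₀) {η : ℝ} (hη : 0 < η) (M : Matrix (Fin m) (Fin n₀) (ZMod 2)) (a : ZMod 2)
    (w : Bits m) : ∑ o, viewRef φ C₀ sel η M a w o = 1 := by
  unfold viewRef
  rw [(orientView a).sum_comp, sum_viewMass]
  simp_rw [sum_msgMass, msgRef, sum_refMass C₀ _ hη, sum_blockMass, prod_wanted_mul_prod_other]
  rw [sum_frameMass_mul sel fun z => ∏ i, recvMass φ (z i), sum_prod_recvMass_one]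

theorem viewRef_pos (φ : unitInterval) {n₀ m : ℕ} (C₀ : Submodule (ZMod 2) (Bits n₀))
    (sel : Selection n₀) {η : ℝ} (hη : 0 < η) (M : Matrix (Fin m) (Fin n₀) (ZMod 2)) (a : ZMod 2)
    (x y : Bits m) (o : View₀ n₀) (h : (runP₀ φ C₀ sel M a x y o).toReal ≠ 0) :
    0 < viewRef φ C₀ sel η M a (if a = 0 then x else y) o := by
  rw [runP₀_eq_viewMass] at h
  have h1 := left_ne_zero_of_mul h
  have h2 := left_ne_zero_of_mul (right_ne_zero_of_mul h)
  have h3 := right_ne_zero_of_mul (right_ne_zero_of_mul h)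
  refine mul_pos (lt_of_le_of_ne (frameMass_nonneg _ _) (Ne.symm h1))
    (mul_pos (lt_of_le_of_ne (msgMass_nonneg ..) (Ne.symm h2))
      (refMass_pos C₀ hη (fun r => blockMass_nonneg φ r _) ?_ _))
  refine lt_of_le_of_ne (sum_nonneg fun r _ => blockMass_nonneg φ r _) fun h0 => h3 ?_
  have h4 := fun r => (sum_eq_zero_iff_of_nonneg fun r _ => blockMass_nonneg φ r _).1 h0.symm r
    (mem_univ r)
  simp [msgMass, h4]

/-- The divergence, in nats, of Bob's view from its reference. -/
def viewDiv (φ : unitInterval) {n₀ m : ℕ} (C₀ : Submodule (ZMod 2) (Bits n₀))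
    (sel : Selection n₀) (η : ℝ) (M : Matrix (Fin m) (Fin n₀) (ZMod 2)) (a : ZMod 2)
    (x y : Bits m) : ℝ :=
  ∑ o, (runP₀ φ C₀ sel M a x y o).toReal * Real.log ((runP₀ φ C₀ sel M a x y o).toReal /
    viewRef φ C₀ sel η M a (if a = 0 then x else y) o)

/-- The true view and the reference share the frame and the wanted message, which cancel in the
logarithm. -/
theorem viewDiv_eq (φ : unitInterval) {n₀ m : ℕ} (C₀ : Submodule (ZMod 2) (Bits n₀))
    (sel : Selection n₀) (η : ℝ) (M : Matrix (Fin m) (Fin n₀) (ZMod 2)) (a : ZMod 2)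
    (x y : Bits m) :
    viewDiv φ C₀ sel η M a x y = ∑ t : Frame n₀,
      frameMass sel t * (∏ j, recvMass φ (wantedBlock t j)) *
        ∑ o, msgMass φ C₀ M (if a = 0 then y else x) (otherBlock t) o *
          Real.log (msgMass φ C₀ M (if a = 0 then y else x) (otherBlock t) o /
            msgRef φ C₀ η (otherBlock t) o) := by
  unfold viewDiv
  simp_rw [runP₀_eq_viewMass, viewRef]
  set w := if a = 0 then x else y
  set v := if a = 0 then y else x
  rw [(orientView a).sum_comp fun o => viewMass sel (msgMass φ C₀ M w) (msgMass φ C₀ M v) o *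
    Real.log (viewMass sel (msgMass φ C₀ M w) (msgMass φ C₀ M v) o /
      viewMass sel (msgMass φ C₀ M w) (msgRef φ C₀ η) o)]
  have h : ∀ o, viewMass sel (msgMass φ C₀ M w) (msgMass φ C₀ M v) o *
    Real.log (viewMass sel (msgMass φ C₀ M w) (msgMass φ C₀ M v) o /
      viewMass sel (msgMass φ C₀ M w) (msgRef φ C₀ η) o) =
      viewMass sel (msgMass φ C₀ M w) (fun z o => msgMass φ C₀ M v z o *
        Real.log (msgMass φ C₀ M v z o / msgRef φ C₀ η z o)) o := by
    intro o
    simp only [viewMass]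
    generalize frameMass sel _ = f
    generalize msgMass φ C₀ M w _ _ = A
    generalize msgMass φ C₀ M v _ _ = B
    generalize msgRef φ C₀ η _ _ = R
    rcases eq_or_ne f 0 with rfl | hf
    · simp
    rcases eq_or_ne A 0 with rfl | hA
    · simp
    rw [show f * (A * B) / (f * (A * R)) = B / R by
      rw [mul_div_mul_left _ _ hf, mul_div_mul_left _ _ hA]]
    ring
  simp_rw [h]
  rw [sum_viewMass]
  simp_rw [sum_msgMass, mul_assoc]

/-- The bound on the information that leaks, in nats. -/
def leakBound (φ : unitInterval) {n₀ : ℕ} (C₀ : Submodule (ZMod 2) (Bits n₀)) (m : ℕ)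
    (η s : ℝ) : ℝ :=
  2 * η + 2 ^ m / #(codewords C₀) * (1 + Real.log η⁻¹) +
    s⁻¹ * (2 ^ m / (#(codewords C₀) * η)) ^ s *
      (erasureProb φ + (1 - erasureProb φ) * √(noiseGen φ s)) ^ (2 * n₀)

/-- Privacy amplification is applied for each fixed frame, permutations included. The resulting
bound depends on the received string alone, whose positions are independent. -/
theorem avg_viewDiv_le (φ : unitInterval) {n₀ m : ℕ} (C₀ : Submodule (ZMod 2) (Bits n₀))
    (sel : Selection n₀) (hsel : sel.OtherIsNoisier) {η s : ℝ} (hη : 0 < η) (hη1 : η ≤ 1)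
    (hs : 0 < s) (hs1 : s ≤ 1) (hρ : 1 ≤ noiseGen φ s) (a : ZMod 2) :
    (Fintype.card (Matrix (Fin m) (Fin n₀) (ZMod 2)) : ℝ)⁻¹ *
      ∑ M : Matrix (Fin m) (Fin n₀) (ZMod 2), ((2 : ℝ) ^ m)⁻¹ * ∑ x, ((2 : ℝ) ^ m)⁻¹ * ∑ y,
        viewDiv φ C₀ sel η M a x y ≤ leakBound φ C₀ m η s := by
  set W : ℝ := (Fintype.card (Matrix (Fin m) (Fin n₀) (ZMod 2)) : ℝ) with hW
  have hV : (Fintype.card (Bits m) : ℝ) = 2 ^ m := by simp [ZMod.card]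
  set G : Matrix (Fin m) (Fin n₀) (ZMod 2) → Bits m → Frame n₀ → ℝ := fun M v t =>
    ∑ o, msgMass φ C₀ M v (otherBlock t) o *
      Real.log (msgMass φ C₀ M v (otherBlock t) o / msgRef φ C₀ η (otherBlock t) o) with hG
  have hsum : ∀ M : Matrix (Fin m) (Fin n₀) (ZMod 2), ∑ x, ((2 : ℝ) ^ m)⁻¹ * ∑ y,
      viewDiv φ C₀ sel η M a x y = ∑ v, ∑ t : Frame n₀,
        frameMass sel t * (∏ j, recvMass φ (wantedBlock t j)) * G M v t := by
    intro M
    simp_rw [viewDiv_eq]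
    by_cases ha : a = 0
    · simp only [ha, if_true]
      rw [sum_const, card_univ, nsmul_eq_mul, hV, mul_inv_cancel_left₀ (by positivity)]
    · simp only [ha, if_false]
      refine sum_congr rfl fun v _ => ?_
      rw [sum_const, card_univ, nsmul_eq_mul, hV, inv_mul_cancel_left₀ (by positivity)]
  have hswap : W⁻¹ * ∑ M : Matrix (Fin m) (Fin n₀) (ZMod 2), ((2 : ℝ) ^ m)⁻¹ * ∑ v,
      ∑ t : Frame n₀, frameMass sel t * (∏ j, recvMass φ (wantedBlock t j)) * G M v t =
      ∑ t : Frame n₀, frameMass sel t * (∏ j, recvMass φ (wantedBlock t j)) *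
        (W⁻¹ * ∑ M : Matrix (Fin m) (Fin n₀) (ZMod 2), ((2 : ℝ) ^ m)⁻¹ * ∑ v, G M v t) := by
    simp_rw [mul_sum]
    simp_rw [sum_comm (s := (univ : Finset (Bits m))) (t := (univ : Finset (Frame n₀)))]
    rw [sum_comm]
    refine sum_congr rfl fun t _ => sum_congr rfl fun M _ => sum_congr rfl fun v _ => ?_
    ring
  set σ := √(noiseGen φ s) with hσ
  have hσ1 : 1 ≤ σ := Real.one_le_sqrt.2 hρ
  have hσ2 : σ ^ 2 = noiseGen φ s := Real.sq_sqrt (zero_le_one.trans hρ)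
  set κ := 2 * η + 2 ^ m / #(codewords C₀) * (1 + Real.log η⁻¹) with hκ
  set γ := s⁻¹ * (2 ^ m / (#(codewords C₀) * η)) ^ s with hγ
  have hγ0 : 0 ≤ γ := by have := card_codewords_pos C₀; positivity
  simp_rw [hsum]
  rw [hswap]
  calc _ ≤ ∑ t : Frame n₀, frameMass sel t * (κ * (∏ i, recvMass φ (t.1 i)) +
        γ * ∏ i, (recvMass φ (t.1 i) * if (t.1 i).1 ≠ (t.1 i).2 then 1 else σ)) := by
        refine sum_le_sum fun t _ => ?_
        have hr0 : ∀ {k : ℕ} (z : Fin k → ZMod 2 × ZMod 2), 0 ≤ ∏ j, recvMass φ (z j) :=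
          fun z => prod_nonneg fun j _ => recvMass_nonneg φ _
        rcases eq_or_ne (frameMass sel t) 0 with h0 | h0
        · simp [h0]
        have ht : t.2.1 ∈ (sel t.1).support := by
          intro h
          exact h0 (by simp [frameMass, h])
        rw [mul_assoc]
        refine mul_le_mul_of_nonneg_left ?_ (frameMass_nonneg sel t)
        have h1 := avg_mixMass_mul_log_le (m := m) C₀ hη hη1
          (fun r => blockMass_nonneg φ r (otherBlock t))
        have h2 := sum_blockMass_log_le φ (m := m) C₀ hη hs hs1 (otherBlock t)
        have h3 : W⁻¹ * ∑ M : Matrix (Fin m) (Fin n₀) (ZMod 2), ((2 : ℝ) ^ m)⁻¹ * ∑ v, G M v t ≤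
            (∏ j, recvMass φ (otherBlock t j)) * κ + γ * ∏ j, (recvMass φ (otherBlock t j) *
              if (otherBlock t j).1 ≠ (otherBlock t j).2 then 1 else noiseGen φ s) := by
          rw [sum_blockMass] at h1
          exact h1.trans (add_le_add_right h2 _)
        refine (mul_le_mul_of_nonneg_left h3 (hr0 _)).trans ?_
        have h4 := prod_noise_le t (hsel _ _ ht) hσ1
        rw [hσ2] at h4
        rw [prod_mul_distrib, prod_mul_distrib, ← prod_wanted_mul_prod_other t (recvMass φ)]
        have h5 := mul_le_mul_of_nonneg_left h4
          (mul_nonneg hγ0 (mul_nonneg (hr0 (wantedBlock t)) (hr0 (otherBlock t))))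
        linarith
    _ = κ + γ * (erasureProb φ + (1 - erasureProb φ) * σ) ^ (2 * n₀) := by
        rw [sum_frameMass_mul sel fun z => κ * (∏ i, recvMass φ (z i)) +
          γ * ∏ i, (recvMass φ (z i) * if (z i).1 ≠ (z i).2 then 1 else σ), sum_add_distrib,
          ← mul_sum, ← mul_sum, sum_prod_recvMass_one, sum_prod_recvMass, mul_one]
    _ = _ := rfl

/-- Either the chosen set has no erasure, or its complement consists of erasures only. -/
theorem otherIsNoisier_of_honest {n₀ : ℕ} {sel : Selection n₀} (h : sel.Honest) :
    sel.OtherIsNoisier := by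
  intro z I hI
  rcases h z I hI with h1 | h1
  · rw [disjoint_iff_inter_eq_empty.1 h1]
    simp
  · have h2 : I.other.1 ∩ erased z = I.other.1 := by
      rw [inter_eq_left]
      intro i hi
      by_contra h3
      exact (mem_compl.1 hi) (h1 (mem_compl.2 h3))
    rw [h2, I.other.2]
    exact (card_le_card inter_subset_left).trans I.2.le

section

open Filter Topology

/-! ### The exponent -/

/-- Convexity of `x ^ (1 + s)` at `2 q` and `2 (1 - q)`, whose mean is `1`. -/
theorem one_le_noiseGen (φ : unitInterval) {s : ℝ} (hs : 0 ≤ s) : 1 ≤ noiseGen φ s := by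
  have hq0 := condCross_nonneg φ
  have hq1 := sub_nonneg.2 (condCross_le_one φ)
  have h := (convexOn_rpow (by linarith : 1 ≤ 1 + s)).2
    (Set.mem_Ici.2 (by positivity : 0 ≤ 2 * condCross φ))
    (Set.mem_Ici.2 (by positivity : 0 ≤ 2 * (1 - condCross φ)))
    (by norm_num : (0 : ℝ) ≤ 1 / 2) (by norm_num : (0 : ℝ) ≤ 1 / 2) (by norm_num)
  simp only [smul_eq_mul] at h
  rw [show 1 / 2 * (2 * condCross φ) + 1 / 2 * (2 * (1 - condCross φ)) = 1 by ring, Real.one_rpow,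
    Real.rpow_one_add' (by positivity) (by linarith),
    Real.rpow_one_add' (by positivity) (by linarith), Real.mul_rpow two_pos.le hq0,
    Real.mul_rpow two_pos.le hq1] at h
  rw [noiseGen]
  linarith

theorem hasDerivAt_mul_rpow {q : ℝ} (hq : 0 ≤ q) :
    HasDerivAt (fun s : ℝ => q * q ^ s) (q * Real.log q) 0 := by
  -- At `q = 0` the function is constantly `0`, although `0 ^ s` jumps at `s = 0`.
  rcases eq_or_lt_of_le hq with rfl | hq
  · simpa using hasDerivAt_const (0 : ℝ) (0 : ℝ)
  · have := ((hasDerivAt_id (0 : ℝ)).const_rpow hq).const_mul q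
    simpa using this

theorem noiseGen_zero (φ : unitInterval) : noiseGen φ 0 = 1 := by
  simp [noiseGen]

theorem hasDerivAt_noiseGen (φ : unitInterval) :
    HasDerivAt (noiseGen φ) (Real.log 2 - Real.binEntropy (condCross φ)) 0 := by
  have h1 := hasDerivAt_mul_rpow (condCross_nonneg φ)
  have h2 := hasDerivAt_mul_rpow (sub_nonneg.2 (condCross_le_one φ))
  have h3 : HasDerivAt (fun s : ℝ => (2 : ℝ) ^ s) (Real.log 2) 0 := by
    simpa using (hasDerivAt_id (0 : ℝ)).const_rpow two_pos
  have h := h3.mul (h1.add h2)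
  refine h.congr_deriv ?_
  rw [Real.binEntropy_eq_negMulLog_add_negMulLog_one_sub]
  simp [Real.negMulLog]
  ring

/-- The logarithmic moment of the number of pairs that are not erased. -/
def momentLog (φ : unitInterval) (s : ℝ) : ℝ :=
  2 * Real.log (erasureProb φ + (1 - erasureProb φ) * √(noiseGen φ s))

/-- The capacity, in nats, of the duplicated channel. -/
def capacity (φ : unitInterval) : ℝ :=
  (1 - erasureProb φ) * (Real.log 2 - Real.binEntropy (condCross φ))

theorem capacity_nonneg (φ : unitInterval) : 0 ≤ capacity φ :=
  mul_nonneg (one_sub_erasureProb_pos φ).le (sub_nonneg.2 Real.binEntropy_le_log_two)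

/-- The square root halves the slope of `noiseGen` and the factor `2` restores it, which gives
exactly the threshold of the rate condition, in nats. -/
theorem hasDerivAt_momentLog (φ : unitInterval) : HasDerivAt (momentLog φ) (capacity φ) 0 := by
  have h1 := (hasDerivAt_noiseGen φ).sqrt (by rw [noiseGen_zero]; exact one_ne_zero)
  have h2 := (h1.const_mul (1 - erasureProb φ)).const_add (erasureProb φ)
  have h3 := (h2.log (by simp [noiseGen_zero])).const_mul 2
  refine h3.congr_deriv ?_
  simp [noiseGen_zero, capacity]
  ring

/-- A function vanishing at `0` stays, just to the right of `0`, below any line steeper than its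
derivative there. -/
theorem exists_momentLog_le (φ : unitInterval) {δ : ℝ} (hδ : 0 < δ) :
    ∃ s : ℝ, 0 < s ∧ s ≤ 1 ∧ momentLog φ s ≤ s * (capacity φ + δ) := by
  have h := (hasDerivAt_momentLog φ).tendsto_slope_zero_right
  have h1 := h.eventually (gt_mem_nhds (lt_add_of_pos_right (capacity φ) hδ))
  have h2 : ∀ᶠ s : ℝ in 𝓝[>] 0, 0 < s := eventually_mem_nhdsWithin
  have h3 : ∀ᶠ s : ℝ in 𝓝[>] 0, s ≤ 1 :=
    eventually_nhdsWithin_of_eventually_nhds (eventually_le_nhds one_pos)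
  obtain ⟨s, hs1, hs2, hs3⟩ := (h1.and (h2.and h3)).exists
  refine ⟨s, hs2, hs3, ?_⟩
  have h0 : momentLog φ 0 = 0 := by simp [momentLog, noiseGen_zero]
  rw [zero_add, h0, sub_zero, smul_eq_mul, inv_mul_lt_iff₀ hs2] at hs1
  exact hs1.le

theorem exists_leakBound_le (φ : unitInterval) {ε : ℝ} (hε : 0 < ε) :
    ∃ s g : ℝ, 0 < s ∧ s ≤ 1 ∧ 0 < g ∧ ∀ (n₀ m : ℕ) (C₀ : Submodule (ZMod 2) (Bits n₀)),
      (m : ℝ) ≤ n₀ * ((Module.finrank (ZMod 2) C₀ : ℝ) / n₀ -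
          (1 - erasureProb φ) * (1 - binEnt ((φ : ℝ) ^ 2 / (1 - erasureProb φ))) - ε) →
        leakBound φ C₀ m (Real.exp (-(g * n₀))) s ≤
          (3 + s⁻¹) * Real.exp (-(s * g * m)) := by
  have hl : 0 < Real.log 2 := Real.log_pos one_lt_two
  -- A quarter of the slack `ε`, in nats: in the noise term one share pays for `η`, one for the
  -- error in `momentLog`, and two are left.
  set g := ε * Real.log 2 / 4 with hg
  have hg0 : 0 < g := by positivity
  obtain ⟨s, hs, hs1, hmom⟩ := exists_momentLog_le φ hg0
  refine ⟨s, g, hs, hs1, hg0, fun n₀ m C₀ hm => ?_⟩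
  set k := Module.finrank (ZMod 2) C₀ with hk
  have hkn : (k : ℝ) ≤ n₀ := by
    have := Submodule.finrank_le C₀
    rw [Module.finrank_fin_fun] at this
    exact_mod_cast this
  have hn0 : (0 : ℝ) ≤ n₀ := Nat.cast_nonneg n₀
  have hcap := capacity_nonneg φ
  have hrate : ((m : ℝ) - k) * Real.log 2 ≤ -(n₀ * (capacity φ + 4 * g)) := by
    -- An inequality suffices and covers `n₀ = 0`, where the quotient is `0` by convention.
    have h1 : (n₀ : ℝ) * (k / n₀) ≤ k := by
      rcases eq_or_ne (n₀ : ℝ) 0 with h | h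
      · simp [h]
      · rw [mul_div_cancel₀ _ h]
    have h2 : (m : ℝ) - k ≤ -(n₀ * ((1 - erasureProb φ) * (1 - binEnt (condCross φ)) + ε)) := by
      unfold condCross
      linarith
    have h3 := mul_le_mul_of_nonneg_right h2 hl.le
    refine h3.trans (le_of_eq ?_)
    rw [capacity, hg, binEnt]
    field_simp
  -- This converts decay in `n₀` into decay in `m`.
  have hmn : (m : ℝ) ≤ n₀ := by
    have : ((m : ℝ) - k) * Real.log 2 ≤ 0 := hrate.trans (by
      have : 0 ≤ n₀ * (capacity φ + 4 * g) := by positivity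
      linarith)
    have h2 : (m : ℝ) - k ≤ 0 := by
      by_contra h
      push Not at h
      have := mul_pos h hl
      linarith
    linarith
  have hratio : (2 : ℝ) ^ m / #(codewords C₀) ≤ Real.exp (-(n₀ * (capacity φ + 4 * g))) := by
    refine le_trans (le_of_eq ?_) (Real.exp_le_exp.2 hrate)
    rw [card_codewords, sub_mul, Real.exp_sub, mul_comm, mul_comm (k : ℝ), Real.exp_mul,
      Real.exp_mul, Real.exp_log two_pos]
    simp [hk]
  have hratio0 : 0 ≤ (2 : ℝ) ^ m / #(codewords C₀) := by positivity
  set E := Real.exp (-(s * g * n₀)) with hE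
  have hsg : s * g * n₀ ≤ g * n₀ := by
    have : s * g ≤ g := mul_le_of_le_one_left hg0.le hs1
    exact mul_le_mul_of_nonneg_right this hn0
  have t1 : Real.exp (-(g * n₀)) ≤ E := Real.exp_le_exp.2 (by linarith)
  have t2 : (2 : ℝ) ^ m / #(codewords C₀) * (1 + Real.log (Real.exp (-(g * n₀)))⁻¹) ≤ E := by
    rw [← Real.exp_neg, neg_neg, Real.log_exp]
    have h1 : 1 + g * n₀ ≤ Real.exp (g * n₀) := by
      have := Real.add_one_le_exp (g * n₀)
      linarith
    calc _ ≤ Real.exp (-(n₀ * (capacity φ + 4 * g))) * Real.exp (g * n₀) := by gcongr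
      _ = Real.exp (-(n₀ * capacity φ) - 3 * (g * n₀)) := by rw [← Real.exp_add]; ring_nf
      _ ≤ E := Real.exp_le_exp.2 (by
        have : 0 ≤ n₀ * capacity φ := by positivity
        have : 0 ≤ g * n₀ := by positivity
        linarith)
  -- The exponent is `s n₀ (-(capacity + 4 g) + g + (capacity + g)) = -2 s g n₀`.
  have t3 : (2 ^ m / (#(codewords C₀) * Real.exp (-(g * n₀)))) ^ s *
      (erasureProb φ + (1 - erasureProb φ) * √(noiseGen φ s)) ^ (2 * n₀) ≤ E := by
    have hb : 0 < erasureProb φ + (1 - erasureProb φ) * √(noiseGen φ s) := by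
      have h1 := one_le_noiseGen φ hs.le
      have h2 : 0 < √(noiseGen φ s) := Real.sqrt_pos.2 (by linarith)
      have := mul_pos (one_sub_erasureProb_pos φ) h2
      have := erasureProb_nonneg φ
      linarith
    have h1 : (erasureProb φ + (1 - erasureProb φ) * √(noiseGen φ s)) ^ (2 * n₀) =
        Real.exp (n₀ * momentLog φ s) := by
      have h2 : n₀ * momentLog φ s = ((2 * n₀ : ℕ) : ℝ) *
          Real.log (erasureProb φ + (1 - erasureProb φ) * √(noiseGen φ s)) := by
        rw [momentLog]
        push_cast
        ring
      rw [h2, Real.exp_nat_mul, Real.exp_log hb]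
    have h2 : (2 ^ m / (#(codewords C₀) * Real.exp (-(g * n₀)))) ^ s ≤
        Real.exp ((-(n₀ * (capacity φ + 4 * g)) + g * n₀) * s) := by
      rw [Real.exp_mul]
      refine Real.rpow_le_rpow (by positivity) ?_ hs.le
      rw [← div_div, div_eq_mul_inv _ (Real.exp _), ← Real.exp_neg, neg_neg, Real.exp_add]
      gcongr
    rw [h1]
    calc _ ≤ Real.exp ((-(n₀ * (capacity φ + 4 * g)) + g * n₀) * s) *
          Real.exp (n₀ * (s * (capacity φ + g))) := by gcongr
      _ = Real.exp (-(s * g * n₀) - s * g * n₀) := by rw [← Real.exp_add]; ring_nf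
      _ ≤ E := Real.exp_le_exp.2 (by
        have : 0 ≤ s * g * n₀ := by positivity
        linarith)
  have hEm : E ≤ Real.exp (-(s * g * m)) := Real.exp_le_exp.2 (by
    have := mul_le_mul_of_nonneg_left hmn (by positivity : 0 ≤ s * g)
    linarith)
  calc leakBound φ C₀ m (Real.exp (-(g * n₀))) s ≤ 2 * E + E + s⁻¹ * E := by
        unfold leakBound
        rw [mul_assoc s⁻¹]
        gcongr
    _ = (3 + s⁻¹) * E := by ring
    _ ≤ _ := by gcongr

end

/-! ### Several runs of `P₀` on correlated secrets -/

/-- The joint law of a uniform parameter `θ`, of the hashing matrices and of Bob's views of `n` runs of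
`P₀`, the `l`-th on the secrets `x θ l` and `y θ l`, Bob asking for the first one if `c l = 0`. -/
def lawRuns (φ : unitInterval) {n₀ m n : ℕ} {Θ : Type} [Fintype Θ] [Nonempty Θ]
    (C₀ : Submodule (ZMod 2) (Bits n₀)) (sel : Selection n₀)
    (hash : PMF (Fin n → Matrix (Fin m) (Fin n₀) (ZMod 2))) (c : Bits n)
    (x y : Θ → Fin n → Bits m) : PMF (Θ × View₁ n₀ m n) :=
  (PMF.uniformOfFintype Θ).bind fun θ => hash.bind fun M =>
    (indep fun l => runP₀ φ C₀ sel (M l) (c l) (x θ l) (y θ l)).bind fun o =>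
      PMF.pure (θ, (M, o))

theorem toReal_lawRuns (φ : unitInterval) {n₀ m n : ℕ} {Θ : Type} [Fintype Θ] [Nonempty Θ]
    (C₀ : Submodule (ZMod 2) (Bits n₀)) (sel : Selection n₀)
    (hash : PMF (Fin n → Matrix (Fin m) (Fin n₀) (ZMod 2))) (c : Bits n)
    (x y : Θ → Fin n → Bits m) (ω : Θ × View₁ n₀ m n) :
    (lawRuns φ C₀ sel hash c x y ω).toReal = (Fintype.card Θ : ℝ)⁻¹ * ((hash ω.2.1).toReal *
      ∏ l, (runP₀ φ C₀ sel (ω.2.1 l) (c l) (x ω.1 l) (y ω.1 l) (ω.2.2 l)).toReal) := by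
  classical
  obtain ⟨θ, M, o⟩ := ω
  unfold lawRuns
  rw [toReal_bind, sum_eq_single θ]
  · rw [toReal_uniform, toReal_bind, sum_eq_single M]
    · rw [toReal_bind, sum_eq_single o]
      · rw [toReal_indep, toReal_pure, if_pos rfl, mul_one]
      · intro o' _ h
        simp [h.symm]
      · simp
    · intro M' _ h
      simp [h.symm]
    · simp
  · intro θ' _ h
    simp [h.symm]
  · simp

/-- The expectation of a function of the parameter and of one run. -/
theorem sum_lawRuns_mul (φ : unitInterval) {n₀ m n : ℕ} {Θ : Type} [Fintype Θ] [Nonempty Θ]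
    (C₀ : Submodule (ZMod 2) (Bits n₀)) (sel : Selection n₀)
    (hash : PMF (Fin n → Matrix (Fin m) (Fin n₀) (ZMod 2)))
    (hhash : ∀ l, hash.map (fun M => M l) = PMF.uniformOfFintype _) (c : Bits n)
    (x y : Θ → Fin n → Bits m) (l : Fin n)
    (F : Θ → Matrix (Fin m) (Fin n₀) (ZMod 2) → View₀ n₀ → ℝ) :
    ∑ ω, (lawRuns φ C₀ sel hash c x y ω).toReal * F ω.1 (ω.2.1 l) (ω.2.2 l) =
      (Fintype.card (Matrix (Fin m) (Fin n₀) (ZMod 2)) : ℝ)⁻¹ *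
        ∑ M : Matrix (Fin m) (Fin n₀) (ZMod 2), (Fintype.card Θ : ℝ)⁻¹ * ∑ θ, ∑ o,
          (runP₀ φ C₀ sel M (c l) (x θ l) (y θ l) o).toReal * F θ M o := by
  set D : Θ → Matrix (Fin m) (Fin n₀) (ZMod 2) → ℝ := fun θ M => ∑ o,
    (runP₀ φ C₀ sel M (c l) (x θ l) (y θ l) o).toReal * F θ M o with hD
  have h1 : ∀ θ (M : Fin n → Matrix (Fin m) (Fin n₀) (ZMod 2)),
      ∑ o : Fin n → View₀ n₀, (∏ l, (runP₀ φ C₀ sel (M l) (c l) (x θ l) (y θ l) (o l)).toReal) *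
        F θ (M l) (o l) = D θ (M l) := fun θ M =>
    sum_prod_mul_apply (fun l o => (runP₀ φ C₀ sel (M l) (c l) (x θ l) (y θ l) o).toReal)
      (fun l => sum_toReal _) l (fun o => F θ (M l) o)
  have h2 : ∀ θ, ∑ M, (hash M).toReal * D θ (M l) =
      (Fintype.card (Matrix (Fin m) (Fin n₀) (ZMod 2)) : ℝ)⁻¹ *
        ∑ M : Matrix (Fin m) (Fin n₀) (ZMod 2), D θ M := by
    intro θ
    rw [← sum_map_mul hash (fun M => M l) (D θ), hhash l, mul_sum]
    simp_rw [toReal_uniform]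
  change _ = _ * ∑ M, _ * ∑ θ, D θ M
  rw [Fintype.sum_prod_type]
  simp_rw [Fintype.sum_prod_type, toReal_lawRuns, mul_assoc, ← mul_sum, h1, h2]
  rw [← mul_sum, sum_comm]
  ring

/-- Information on the unwanted secrets that leaks in `n` runs of `P₀`: each run leaks at most
`leakBound`, whatever the joint law of the hashing matrices. -/
theorem le_condEntropy_lawRuns (φ : unitInterval) {n₀ m n : ℕ} {Θ A B : Type} [Fintype Θ]
    [Nonempty Θ] [Fintype A] [Fintype B] (C₀ : Submodule (ZMod 2) (Bits n₀)) (sel : Selection n₀)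
    (hsel : sel.OtherIsNoisier)
    (hash : PMF (Fin n → Matrix (Fin m) (Fin n₀) (ZMod 2)))
    (hhash : ∀ l, hash.map (fun M => M l) = PMF.uniformOfFintype _) (c : Bits n)
    (x y : Θ → Fin n → Bits m) (α : Θ → A) (f : (Fin n → Bits m) × View₁ n₀ m n → B)
    (hinj : Function.Injective fun θ => (α θ, fun l => if c l = 0 then x θ l else y θ l))
    (hxy : ∀ l, (∀ θ, x θ l = y θ l) ∨ ∀ F : Bits m → Bits m → ℝ,
      (Fintype.card Θ : ℝ)⁻¹ * ∑ θ, F (x θ l) (y θ l) =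
        ((2 : ℝ) ^ m)⁻¹ * ∑ a, ((2 : ℝ) ^ m)⁻¹ * ∑ b, F a b)
    {η s : ℝ} (hη : 0 < η) (hη1 : η ≤ 1) (hs : 0 < s) (hs1 : s ≤ 1) :
    Real.log (Fintype.card Θ) - n * m * Real.log 2 - n * leakBound φ C₀ m η s ≤
      Real.log 2 * condEntropy ((lawRuns φ C₀ sel hash c x y).map fun ω =>
        (α ω.1, f (fun l => if c l = 0 then x ω.1 l else y ω.1 l, ω.2))) := by
  classical
  have hΘ : (0 : ℝ) < Fintype.card Θ := by exact_mod_cast Fintype.card_pos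
  have hleak : 0 ≤ leakBound φ C₀ m η s := by
    have h1 := erasureProb_nonneg φ
    have h2 := (one_sub_erasureProb_pos φ).le
    have h3 : 0 ≤ Real.log η⁻¹ := Real.log_nonneg ((one_le_inv₀ hη).2 hη1)
    have h4 := card_codewords_pos C₀
    unfold leakBound
    positivity
  set K : Θ → View₁ n₀ m n → Fin n → ℝ := fun θ V l =>
    (runP₀ φ C₀ sel (V.1 l) (c l) (x θ l) (y θ l) (V.2 l)).toReal with hK
  -- If the two strings of a run always agree there is nothing to hide: the true law serves as
  -- reference and the log ratio vanishes.
  set R : Fin n → Matrix (Fin m) (Fin n₀) (ZMod 2) → Bits m → View₀ n₀ → ℝ := fun l M w o =>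
    if ∀ θ, x θ l = y θ l then (runP₀ φ C₀ sel M (c l) w w o).toReal
    else viewRef φ C₀ sel η M (c l) w o with hR
  set w : Θ → Fin n → Bits m := fun θ l => if c l = 0 then x θ l else y θ l with hw
  have hR0 : ∀ l M w o, 0 ≤ R l M w o := by
    intro l M w o
    simp only [hR]
    split_ifs
    · exact ENNReal.toReal_nonneg
    · exact viewRef_nonneg φ C₀ sel hη M (c l) w o
  have hR1 : ∀ l M w, ∑ o, R l M w o = 1 := by
    intro l M w
    simp only [hR]
    split_ifs
    · exact sum_toReal _
    · exact sum_viewRef φ C₀ sel hη M (c l) w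
  have hRK : ∀ θ V l, (∀ θ, x θ l = y θ l) → R l (V.1 l) (w θ l) (V.2 l) = K θ V l := by
    intro θ V l h
    simp only [hR, hK, hw]
    rw [if_pos h, h θ, ite_self]
  have hRpos : ∀ θ V l, K θ V l ≠ 0 → 0 < R l (V.1 l) (w θ l) (V.2 l) := by
    intro θ V l h
    by_cases hd : ∀ θ, x θ l = y θ l
    · rw [hRK θ V l hd]
      exact lt_of_le_of_ne ENNReal.toReal_nonneg (Ne.symm h)
    · simp only [hR, if_neg hd]
      exact viewRef_pos φ C₀ sel hη (V.1 l) (c l) (x θ l) (y θ l) (V.2 l) h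
  -- Uniform wanted strings, the true law of the matrices, independent reference runs. The uniform
  -- factor is what subtracts `n * m` bits.
  set q : (Fin n → Bits m) × View₁ n₀ m n → ℝ := fun b =>
    ((2 : ℝ) ^ (n * m))⁻¹ * ((hash b.2.1).toReal * ∏ l, R l (b.2.1 l) (b.1 l) (b.2.2 l)) with hq
  have hq0 : ∀ b, 0 ≤ q b := fun b => mul_nonneg (by positivity)
    (mul_nonneg ENNReal.toReal_nonneg (prod_nonneg fun l _ => hR0 _ _ _ _))
  have hq1 : ∑ b, q b ≤ 1 := by
    rw [Fintype.sum_prod_type]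
    simp_rw [Fintype.sum_prod_type]
    simp only [hq]
    have h1 : ∀ (M : Fin n → Matrix (Fin m) (Fin n₀) (ZMod 2)) (v : Fin n → Bits m),
        ∑ o : Fin n → View₀ n₀, ∏ l, R l (M l) (v l) (o l) = 1 := by
      intro M v
      rw [← Fintype.prod_sum fun l o => R l (M l) (v l) o]
      simp [hR1]
    simp_rw [← mul_sum, h1, mul_one, sum_toReal]
    rw [sum_const, card_univ, nsmul_eq_mul]
    refine le_of_eq ?_
    have h2 : (Fintype.card (Fin n → Bits m) : ℝ) = 2 ^ (n * m) := by
      simp [ZMod.card, pow_mul, pow_right_comm]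
    rw [h2]
    field_simp
  have hppos : ∀ ω : Θ × View₁ n₀ m n, (lawRuns φ C₀ sel hash c x y ω).toReal ≠ 0 →
      (hash ω.2.1).toReal ≠ 0 ∧ ∀ l, K ω.1 ω.2 l ≠ 0 := by
    intro ω h
    rw [toReal_lawRuns] at h
    have h1 := right_ne_zero_of_mul h
    exact ⟨left_ne_zero_of_mul h1, fun l =>
      prod_ne_zero_iff.1 (right_ne_zero_of_mul h1) l (mem_univ l)⟩
  -- The finer observer knows all wanted strings; `f` recovers from them what the entropy is
  -- conditioned on.
  have hmain := variational_le_condEntropy (lawRuns φ C₀ sel hash c x y) (fun ω => α ω.1)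
    (fun ω => f (w ω.1, ω.2)) (fun ω => (w ω.1, ω.2)) f (fun ω => rfl)
    (by
      rintro ⟨θ, V⟩ ⟨θ', V'⟩ h
      simp only [Prod.mk.injEq] at h
      obtain ⟨h1, h2, h3⟩ := h
      have : θ = θ' := hinj (Prod.ext h1 h2)
      rw [this, h3])
    q hq0 hq1
    (by
      intro ω h
      obtain ⟨h1, h2⟩ := hppos ω h
      exact mul_pos (by positivity) (mul_pos
        (lt_of_le_of_ne ENNReal.toReal_nonneg (Ne.symm h1))
        (prod_pos fun l _ => hRpos ω.1 ω.2 l (h2 l))))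
  refine le_trans ?_ hmain
  -- The mass of `hash` cancels in the ratio, and the logarithm of the product becomes a sum over
  -- runs.
  have hlog : ∀ ω : Θ × View₁ n₀ m n, (lawRuns φ C₀ sel hash c x y ω).toReal *
      Real.log (q (w ω.1, ω.2) / (lawRuns φ C₀ sel hash c x y ω).toReal) =
      (lawRuns φ C₀ sel hash c x y ω).toReal *
        (Real.log (Fintype.card Θ) - n * m * Real.log 2) -
      ∑ l, (lawRuns φ C₀ sel hash c x y ω).toReal *
        Real.log (K ω.1 ω.2 l / R l (ω.2.1 l) (w ω.1 l) (ω.2.2 l)) := by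
    intro ω
    rcases eq_or_ne (lawRuns φ C₀ sel hash c x y ω).toReal 0 with h | h
    · simp [h]
    obtain ⟨h1, h2⟩ := hppos ω h
    have h3 := fun l => hRpos ω.1 ω.2 l (h2 l)
    rw [← mul_sum, ← mul_sub]
    congr 1
    rw [← Real.log_prod fun l _ => div_ne_zero (h2 l) (h3 l).ne', prod_div_distrib]
    have h4 : q (w ω.1, ω.2) / (lawRuns φ C₀ sel hash c x y ω).toReal =
        Fintype.card Θ / 2 ^ (n * m) /
          ((∏ l, K ω.1 ω.2 l) / ∏ l, R l (ω.2.1 l) (w ω.1 l) (ω.2.2 l)) := by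
      rw [toReal_lawRuns]
      simp only [hq]
      change _ / (_ * (_ * ∏ l, K ω.1 ω.2 l)) = _
      have h5 : ∏ l, K ω.1 ω.2 l ≠ 0 := prod_ne_zero_iff.2 fun l _ => h2 l
      have h6 : ∏ l, R l (ω.2.1 l) (w ω.1 l) (ω.2.2 l) ≠ 0 :=
        prod_ne_zero_iff.2 fun l _ => (h3 l).ne'
      field_simp
    rw [h4, Real.log_div (by positivity) (div_ne_zero (prod_ne_zero_iff.2 fun l _ => h2 l)
      (prod_ne_zero_iff.2 fun l _ => (h3 l).ne')), Real.log_div hΘ.ne' (by positivity),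
      Real.log_pow]
    push_cast
    ring
  simp_rw [hlog]
  rw [sum_sub_distrib, ← sum_mul, sum_toReal, one_mul, sum_comm]
  have hl : ∀ l, ∑ ω, (lawRuns φ C₀ sel hash c x y ω).toReal *
      Real.log (K ω.1 ω.2 l / R l (ω.2.1 l) (w ω.1 l) (ω.2.2 l)) ≤ leakBound φ C₀ m η s := by
    intro l
    by_cases hd : ∀ θ, x θ l = y θ l
    · refine le_trans (le_of_eq (sum_eq_zero fun ω _ => ?_)) hleak
      rw [hRK ω.1 ω.2 l hd]
      rcases eq_or_ne (K ω.1 ω.2 l) 0 with h | h <;> simp [h]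
    -- The expectation for run `l` involves only its own pair of strings and its own matrix, which
    -- are uniform and independent, so the single-run bound applies.
    · have h1 := (hxy l).resolve_left hd
      have h2 := sum_lawRuns_mul φ C₀ sel hash hhash c x y l fun θ M o =>
        Real.log ((runP₀ φ C₀ sel M (c l) (x θ l) (y θ l) o).toReal / R l M (w θ l) o)
      refine (le_of_eq h2).trans (le_trans (le_of_eq ?_)
        (avg_viewDiv_le φ C₀ sel hsel hη hη1 hs hs1 (one_le_noiseGen φ hs.le) (c l)))
      congr 1
      refine sum_congr rfl fun M _ => ?_
      rw [← h1 fun a b => viewDiv φ C₀ sel η M (c l) a b]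
      congr 1
      refine sum_congr rfl fun θ _ => ?_
      simp only [hR, if_neg hd, hw, viewDiv]
  have hsum := sum_le_card_nsmul univ _ _ fun l _ => hl l
  rw [card_univ, Fintype.card_fin, nsmul_eq_mul] at hsum
  linarith

/-! ### The two protocols as runs of `P₀` on correlated secrets -/

theorem indep_map_apply {ι κ : Type} [Fintype ι] [DecidableEq ι] [Fintype κ] (p : ι → PMF κ)
    (l : ι) : (indep p).map (fun f => f l) = p l := by
  classical
  ext b
  refine (ENNReal.toReal_eq_toReal_iff' (PMF.apply_ne_top _ _) (PMF.apply_ne_top _ _)).1 ?_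
  have h := sum_prod_mul_apply (fun i a => (p i a).toReal) (fun i => sum_toReal (p i)) l
    fun a => if b = a then 1 else 0
  rw [toReal_map]
  simp_rw [toReal_indep]
  simpa using h

/-- Averages are preserved by surjective homomorphisms. -/
theorem avg_comp_of_surjective {G H : Type} [AddGroup G] [Fintype G] [AddGroup H] [Fintype H]
    (f : G →+ H) (hf : Function.Surjective f) (F : H → ℝ) :
    (Fintype.card G : ℝ)⁻¹ * ∑ g, F (f g) = (Fintype.card H : ℝ)⁻¹ * ∑ h, F h := by
  classical
  have hc : ∀ h : H, (Fintype.card G : ℝ)⁻¹ * #{g | f g = h} = (Fintype.card H : ℝ)⁻¹ := by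
    intro h
    have h1 := card_fiber_of_surjective f hf h
    have h2 : (#{g | f g = h} : ℝ) ≠ 0 := by
      obtain ⟨g, hg⟩ := hf h
      exact_mod_cast (card_pos.2 ⟨g, by simpa using hg⟩).ne'
    rw [← h1]
    push_cast
    field_simp
  rw [← sum_fiberwise univ f fun g => F (f g), mul_sum, mul_sum]
  refine sum_congr rfl fun h _ => ?_
  rw [← hc h, sum_congr rfl (g := fun _ => F h) fun g hg => by rw [(mem_filter.1 hg).2],
    sum_const, nsmul_eq_mul, mul_assoc]

theorem lawP₀_eq (φ : unitInterval) {n₀ : ℕ} (m : ℕ) (C₀ : Submodule (ZMod 2) (Bits n₀))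
    (sel : Selection n₀) (a : ZMod 2) :
    lawP₀ φ m C₀ sel a = (lawRuns (n := 1) (Θ := Bits m × Bits m) φ C₀ sel
      ((PMF.uniformOfFintype _).map fun M _ => M) (fun _ => a) (fun θ _ => θ.1)
        fun θ _ => θ.2).map fun ω => (ω.1, (ω.2.1 0, ω.2.2 0)) := by
  classical
  unfold lawP₀ lawRuns
  simp only [bind, pure, PMF.map_bind, PMF.pure_map, PMF.bind_map, Function.comp_def]
  have h1 : ∀ (θ : Bits m × Bits m) (M : Matrix (Fin m) (Fin n₀) (ZMod 2)),
      ((indep fun _ : Fin 1 => runP₀ φ C₀ sel M a θ.1 θ.2).bind fun o => PMF.pure (θ, (M, o 0))) =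
        (runP₀ φ C₀ sel M a θ.1 θ.2).bind fun o => PMF.pure (θ, (M, o)) := by
    intro θ M
    conv_rhs => rw [← indep_map_apply (fun _ : Fin 1 => runP₀ φ C₀ sel M a θ.1 θ.2) 0,
      PMF.bind_map]
    rfl
  simp_rw [h1]
  ext b
  refine (ENNReal.toReal_eq_toReal_iff' (PMF.apply_ne_top _ _) (PMF.apply_ne_top _ _)).1 ?_
  rw [toReal_bind, toReal_bind, Fintype.sum_prod_type]
  refine sum_congr rfl fun x _ => ?_
  rw [toReal_bind, mul_sum]
  refine sum_congr rfl fun y _ => ?_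
  simp only [toReal_uniform, Fintype.card_prod]
  push_cast
  rw [mul_inv, mul_assoc]

theorem zmod_two_add_self {ι κ : Type} (A : Matrix ι κ (ZMod 2)) : A + A = 0 := by
  ext i j
  exact CharTwo.add_self_eq_zero (A i j)

/-- Vectors of `k` strings of `m` bits, stored as the rows of a matrix. -/
abbrev Strings (k m : ℕ) := Matrix (Fin k) (Fin m) (ZMod 2)

/-- The second vector of secrets that Alice feeds into the runs of `P₀` in `P₁`. -/
def shifted {r n m : ℕ} (H : Matrix (Fin r) (Fin n) (ZMod 2))
    (θ : Strings n m × Strings r m) : Strings n m :=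
  θ.1 + H.transpose * θ.2

theorem mul_left_surjective {r n m : ℕ} {H : Matrix (Fin r) (Fin n) (ZMod 2)}
    (hH : H * H.transpose = 1) :
    Function.Surjective fun x : Matrix (Fin n) (Fin m) (ZMod 2) => H * x := fun s =>
  ⟨H.transpose * s, by simp [← Matrix.mul_assoc, hH]⟩

/-- Change of variables from `(s, t, x)` to `(x, d)` with `d = s + t`. As `H` is surjective with
fibres of equal size, `x` is uniform and independent of the uniform `d`; in characteristic two, `t =
d + H x`. -/
theorem lawP₁_eq (φ : unitInterval) {n₀ m r n : ℕ} (C₀ : Submodule (ZMod 2) (Bits n₀))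
    (sel : Selection n₀) (hash : PMF (Fin n → Matrix (Fin m) (Fin n₀) (ZMod 2)))
    (H : Matrix (Fin r) (Fin n) (ZMod 2)) (hH : H * H.transpose = 1) (u : Bits n) (a : ZMod 2) :
    lawP₁ φ C₀ sel hash H hH u a =
      (lawRuns (Θ := Strings n m × Strings r m) φ C₀ sel hash (fun l => u l + a)
        (fun θ l => θ.1 l) (fun θ l => shifted H θ l)).map
        fun ω : (Strings n m × Strings r m) × View₁ n₀ m n => ((H * ω.1.1, ω.1.2 + H * ω.1.1), ω.2) := by
  classical
  unfold lawP₁ lawRuns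
  simp only [bind, pure, PMF.map_bind, PMF.pure_map]
  ext b
  refine (ENNReal.toReal_eq_toReal_iff' (PMF.apply_ne_top _ _) (PMF.apply_ne_top _ _)).1 ?_
  set G : Strings r m → Strings r m → Strings n m → ℝ := fun s d x => ((hash.bind fun M =>
    (indep fun l => runP₀ φ C₀ sel (M l) (u l + a) (x l) ((x + H.transpose * d) l)).bind fun o =>
      PMF.pure ((s, d + s), (M, o))) b).toReal with hG
  have hcard : ∀ s : Strings r m, (Fintype.card (Strings r m) : ℝ)⁻¹ * (#(maskSet (m := m) H s) : ℝ)⁻¹ =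
      (Fintype.card (Strings n m) : ℝ)⁻¹ := by
    intro s
    let f : Strings n m →+ Strings r m := ⟨⟨fun x => H * x, Matrix.mul_zero H⟩, Matrix.mul_add H⟩
    have h := card_fiber_of_surjective f (mul_left_surjective hH) s
    rw [← mul_inv, ← h]
    push_cast
    rfl
  have hL : ∀ s : Strings r m, ((PMF.uniformOfFintype (Strings r m)).bind (fun t =>
      (PMF.uniformOfFinset (maskSet H s) (maskSet_nonempty hH s)).bind fun x =>
        hash.bind fun M => (indep fun l => runP₀ φ C₀ sel (M l) (u l + a) (x l)
          ((x + H.transpose * (s + t)) l)).bind fun o => PMF.pure ((s, t), (M, o))) b).toReal =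
      (Fintype.card (Strings r m) : ℝ)⁻¹ * ∑ d, ∑ x, (if H * x = s then (#(maskSet (m := m) H s) : ℝ)⁻¹ else 0) *
        G s d x := by
    intro s
    rw [toReal_bind, mul_sum]
    refine (Fintype.sum_equiv (Equiv.addRight s) _ _ fun d => ?_).symm
    rw [toReal_uniform, toReal_bind]
    congr 1
    refine sum_congr rfl fun x _ => ?_
    have h1 : s + (Equiv.addRight s) d = d := by
      rw [Equiv.coe_addRight, add_comm s, add_assoc, zmod_two_add_self, add_zero]
    rw [h1]
    congr 1
    simp [PMF.uniformOfFinset_apply, maskSet, apply_ite ENNReal.toReal]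
  rw [toReal_bind, toReal_bind]
  simp_rw [hL, toReal_uniform]
  rw [Fintype.sum_prod_type]
  calc _ = ∑ s : Strings r m, ∑ d, ∑ x, if H * x = s then
        (Fintype.card (Strings r m) : ℝ)⁻¹ * (Fintype.card (Strings n m) : ℝ)⁻¹ * G s d x else 0 := by
        simp_rw [mul_sum]
        refine sum_congr rfl fun s _ => sum_congr rfl fun d _ => sum_congr rfl fun x _ => ?_
        rw [← hcard s]
        split_ifs <;> ring
    _ = ∑ x, ∑ d, (Fintype.card (Strings r m) : ℝ)⁻¹ * (Fintype.card (Strings n m) : ℝ)⁻¹ * G (H * x) d x := by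
        rw [sum_comm, sum_congr rfl fun d _ => sum_comm, sum_comm]
        refine sum_congr rfl fun x _ => sum_congr rfl fun d _ => ?_
        simp
    _ = _ := by
        refine sum_congr rfl fun x _ => sum_congr rfl fun d _ => ?_
        rw [Fintype.card_prod, Nat.cast_mul, mul_inv, mul_comm (Fintype.card (Strings r m) : ℝ)⁻¹]
        rfl

/-- The wanted strings form `x + diag(u) Hᵀ d + a Hᵀ d`. The entries of `H diag(u) Hᵀ` are the
pairings of `u` with products of two rows of `H`, hence zero, so these strings determine the wanted
secret. -/
theorem mul_wanted {r n m : ℕ} {H : Matrix (Fin r) (Fin n) (ZMod 2)} (hH : H * H.transpose = 1)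
    {u : Bits n} (hu : ∀ w ∈ schurSquare (rowCode H), u ⬝ᵥ w = 0) (a : ZMod 2)
    (x : Matrix (Fin n) (Fin m) (ZMod 2)) (d : Matrix (Fin r) (Fin m) (ZMod 2)) :
    H * Matrix.of (fun l => if u l + a = 0 then x l else shifted H (x, d) l) = H * x + a • d := by
  have hw : Matrix.of (fun l => if u l + a = 0 then x l else shifted H (x, d) l) =
      x + Matrix.diagonal u * (H.transpose * d) + a • (H.transpose * d) := by
    ext l j
    rw [Matrix.add_apply, Matrix.add_apply, Matrix.diagonal_mul, Matrix.smul_apply, smul_eq_mul,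
      add_assoc, ← add_mul]
    rcases zmod_two_cases (u l + a) with h | h
    · simp [h]
    · simp [h, shifted]
  have hd : H * (Matrix.diagonal u * H.transpose) = 0 := by
    ext i k
    have h := hu (H i * H k) (Submodule.subset_span
      ⟨H i, Submodule.subset_span ⟨i, rfl⟩, H k, Submodule.subset_span ⟨k, rfl⟩, rfl⟩)
    rw [Matrix.mul_apply, Matrix.zero_apply, ← h]
    refine sum_congr rfl fun l _ => ?_
    rw [Matrix.diagonal_mul, Matrix.transpose_apply, Pi.mul_apply]
    ring
  rw [hw, Matrix.mul_add, Matrix.mul_add, ← Matrix.mul_assoc (Matrix.diagonal u),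
    ← Matrix.mul_assoc H, hd, Matrix.zero_mul, add_zero, Matrix.mul_smul, ← Matrix.mul_assoc, hH,
    Matrix.one_mul]

theorem residual_lawP₀_ge (φ : unitInterval) {n₀ m : ℕ} (C₀ : Submodule (ZMod 2) (Bits n₀))
    (sel : Selection n₀) (hsel : sel.OtherIsNoisier) (a : ZMod 2) {η s : ℝ} (hη : 0 < η)
    (hη1 : η ≤ 1) (hs : 0 < s) (hs1 : s ≤ 1) :
    m * Real.log 2 - leakBound φ C₀ m η s ≤
      Real.log 2 * residual a (lawP₀ φ m C₀ sel a) := by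
  have hV : (Fintype.card (Bits m) : ℝ) = 2 ^ m := by simp [ZMod.card]
  have h := le_condEntropy_lawRuns (n := 1) (Θ := Bits m × Bits m) φ C₀ sel hsel
    ((PMF.uniformOfFintype (Matrix (Fin m) (Fin n₀) (ZMod 2))).map fun M _ => M)
    (fun l => by rw [PMF.map_comp]; exact PMF.map_id _)
    (fun _ => a) (fun θ _ => θ.1) (fun θ _ => θ.2) (fun θ => if a = 0 then θ.2 else θ.1)
    (fun b => (b.1 0, (b.2.1 0, b.2.2 0)))
    (by
      rintro ⟨x, y⟩ ⟨x', y'⟩ h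
      simp only [Prod.mk.injEq] at h
      have h2 := congrFun h.2 0
      have h1 := h.1
      by_cases ha : a = 0
      · simp only [ha, if_true] at h1 h2
        rw [h1, h2]
      · simp only [ha, if_false] at h1 h2
        rw [h1, h2])
    (fun l => Or.inr fun F => by
      rw [Fintype.card_prod, Nat.cast_mul, hV, Fintype.sum_prod_type, mul_inv, mul_assoc, mul_sum])
    hη hη1 hs hs1
  have hl : Real.log (Fintype.card (Bits m × Bits m)) = 2 * (m * Real.log 2) := by
    rw [Fintype.card_prod, Nat.cast_mul, hV, Real.log_mul (by positivity) (by positivity),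
      Real.log_pow]
    ring
  rw [hl, Nat.cast_one, one_mul, one_mul] at h
  rw [lawP₀_eq]
  refine le_trans (by linarith) (h.trans (le_of_eq ?_))
  unfold residual
  by_cases ha : a = 0
  · simp only [ha, if_true, PMF.map_comp]
    rfl
  · simp only [ha, if_false, PMF.map_comp]
    rfl

/-- The parameter `(x, d)` has `n m + r m` bits, of which the wanted strings account for `n m`. -/
theorem residual_lawP₁_ge (φ : unitInterval) {n₀ m r n : ℕ} (C₀ : Submodule (ZMod 2) (Bits n₀))
    (sel : Selection n₀) (hsel : sel.OtherIsNoisier)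
    (hash : PMF (Fin n → Matrix (Fin m) (Fin n₀) (ZMod 2)))
    (hhash : ∀ l, hash.map (fun M => M l) = PMF.uniformOfFintype _)
    (H : Matrix (Fin r) (Fin n) (ZMod 2)) (hH : H * H.transpose = 1) (u : Bits n)
    (hu : ∀ w ∈ schurSquare (rowCode H), u ⬝ᵥ w = 0) (a : ZMod 2) {η s : ℝ} (hη : 0 < η)
    (hη1 : η ≤ 1) (hs : 0 < s) (hs1 : s ≤ 1) :
    r * m * Real.log 2 - n * leakBound φ C₀ m η s ≤
      Real.log 2 * residual a (lawP₁ φ C₀ sel hash H hH u a) := by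
  have hV : (Fintype.card (Bits m) : ℝ) = 2 ^ m := by simp [ZMod.card]
  have hl : Real.log (Fintype.card (Strings n m × Strings r m)) = (n * m + r * m) * Real.log 2 := by
    have h1 : (Fintype.card (Strings n m × Strings r m) : ℝ) = 2 ^ (n * m + r * m) := by
      have hX : Fintype.card (Strings n m) = 2 ^ (n * m) := by
        simp [Matrix, ZMod.card, pow_mul, pow_right_comm]
      have hS : Fintype.card (Strings r m) = 2 ^ (r * m) := by
        simp [Matrix, ZMod.card, pow_mul, pow_right_comm]
      rw [Fintype.card_prod, hX, hS, ← pow_add]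
      push_cast
      rfl
    rw [h1, Real.log_pow]
    push_cast
    ring
  have hw : ∀ θ : Strings n m × Strings r m, H * Matrix.of (fun l => if u l + a = 0 then θ.1 l else shifted H θ l) =
      H * θ.1 + a • θ.2 := fun θ => mul_wanted hH hu a θ.1 θ.2
  have h := le_condEntropy_lawRuns (Θ := Strings n m × Strings r m) φ C₀ sel hsel hash hhash (fun l => u l + a)
    (fun θ l => θ.1 l) (fun θ l => shifted H θ l)
    (fun θ => if a = 0 then θ.2 + H * θ.1 else H * θ.1)
    (fun b => (H * Matrix.of b.1, b.2))
    (by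
      rintro ⟨x, d⟩ ⟨x', d'⟩ h
      simp only [Prod.mk.injEq] at h
      obtain ⟨h1, h2⟩ := h
      have h3 : H * x + a • d = H * x' + a • d' := by
        rw [← hw (x, d), ← hw (x', d')]
        exact congrArg (fun w => H * Matrix.of w) h2
      -- Both secrets agree, hence so does their sum `d`; each `x l` is then read off from the
      -- string wanted in run `l`.
      have h4 : d = d' := by
        rcases zmod_two_cases a with ha | ha
        · simp only [ha, if_true, zero_smul, add_zero] at h1 h3
          rw [h3] at h1
          exact add_right_cancel h1
        · simp only [ha, one_ne_zero, if_false, one_smul] at h1 h3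
          rw [h1] at h3
          exact add_left_cancel h3
      subst h4
      have h5 : x = x' := by
        ext l j
        have h6 := congrFun (congrFun h2 l) j
        by_cases hc : u l + a = 0
        · simpa [hc] using h6
        · simpa [hc, shifted] using h6
      rw [h5])
    (fun l => by
      -- A zero column makes the two strings of run `l` equal. A nonzero one makes this pair the
      -- image of `(x, d)` under a surjective homomorphism, hence uniform.
      by_cases hcol : ∀ k, H k l = 0
      · refine Or.inl fun θ => ?_
        ext j
        simp [shifted, Matrix.mul_apply, hcol]
      · right
        push Not at hcol
        obtain ⟨k, hk⟩ := hcol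
        have hk1 : H k l = 1 := (zmod_two_cases _).resolve_left hk
        intro F
        let f : Strings n m × Strings r m →+ Bits m × Bits m :=
          ⟨⟨fun θ => (θ.1 l, shifted H θ l), by
            ext j <;> simp [shifted]⟩, fun θ θ' => by
            ext j
            · simp
            · simp [shifted, Matrix.mul_add]
              ring⟩
        have hf : Function.Surjective f := by
          rintro ⟨b, b'⟩
          -- Since `H k l = 1`, row `k` of `d` alone can carry the difference of the two strings.
          refine ⟨(Matrix.of fun _ => b, Matrix.of fun k' => if k' = k then b' - b else 0), ?_⟩
          ext j
          · simp [f]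
          · simp [f, shifted, Matrix.mul_apply, ite_apply, hk1]
        have h1 := avg_comp_of_surjective f hf fun b => F b.1 b.2
        rw [Fintype.card_prod (Bits m), Nat.cast_mul, hV, Fintype.sum_prod_type (α₁ := Bits m),
          mul_inv, mul_assoc, mul_sum (s := (univ : Finset (Bits m)))] at h1
        exact h1)
    hη hη1 hs hs1
  rw [hl] at h
  rw [lawP₁_eq]
  refine le_trans (by linarith) (h.trans (le_of_eq ?_))
  unfold residual
  rcases zmod_two_cases a with ha | ha
  · subst ha
    simp only [if_true, PMF.map_comp]
    congr 3
    funext ω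
    simp only [Function.comp, Prod.mk.injEq, true_and, and_true]
    refine (hw ω.1).trans ?_
    simp
  · subst ha
    simp only [one_ne_zero, if_false, PMF.map_comp]
    congr 3
    funext ω
    simp only [Function.comp, Prod.mk.injEq, true_and, and_true]
    refine (hw ω.1).trans ?_
    simp [add_comm]

/-! ### The exponentially small leakage function -/

theorem exponentiallySmall_exp (A : ℝ) {β : ℝ} (hβ : 0 < β) :
    ExponentiallySmall fun m => A * Real.exp (-(β * m)) :=
  ⟨|A|, β, hβ, fun m => by rw [abs_mul, Real.abs_exp]⟩

end OT

end

theorem mainTheorem6 (φ : unitInterval) (hφ : (φ : ℝ) < 1 / 2) :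
    ∃ f₀ : ℝ → ℕ → ℝ,
      (∀ ε : ℝ, 0 < ε → OT.ExponentiallySmall (f₀ ε)) ∧
      ∀ ε : ℝ, 0 < ε → ∀ (n₀ m : ℕ) (C₀ : Submodule (ZMod 2) (OT.Bits n₀)),
        (m : ℝ) ≤ n₀ * ((Module.finrank (ZMod 2) C₀ : ℝ) / n₀ -
          (1 - OT.erasureProb φ) * (1 - OT.binEnt ((φ : ℝ) ^ 2 / (1 - OT.erasureProb φ))) - ε) →
        -- the leakage of a single run of `P₀` is at most `f₀ ε m`
        (∀ sel : OT.Selection n₀, sel.OtherIsNoisier → ∀ a : ZMod 2,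
          (m : ℝ) - f₀ ε m ≤ OT.residual a (OT.lawP₀ φ m C₀ sel a)) ∧
        -- the leakage of `P₁` is at most `n * f₀ ε m`
        (∀ sel : OT.Selection n₀, sel.Honest →
          ∀ (r n : ℕ) (H : Matrix (Fin r) (Fin n) (ZMod 2)) (hH : H * H.transpose = 1)
            (u : OT.Bits n), (∀ w ∈ OT.schurSquare (OT.rowCode H), u ⬝ᵥ w = 0) →
          ∀ hash : PMF (Fin n → Matrix (Fin m) (Fin n₀) (ZMod 2)),
            (∀ l, hash.map (fun M => M l) = PMF.uniformOfFintype _) →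
          ∀ a : ZMod 2,
            (r : ℝ) * m - n * f₀ ε m ≤ OT.residual a (OT.lawP₁ φ C₀ sel hash H hH u a)) := by
  have hl : 0 < Real.log 2 := Real.log_pos one_lt_two
  have hex : ∀ ε : ℝ, ∃ s g : ℝ, 0 < ε → 0 < s ∧ s ≤ 1 ∧ 0 < g ∧
      ∀ (n₀ m : ℕ) (C₀ : Submodule (ZMod 2) (OT.Bits n₀)),
        (m : ℝ) ≤ n₀ * ((Module.finrank (ZMod 2) C₀ : ℝ) / n₀ -
          (1 - OT.erasureProb φ) * (1 - OT.binEnt ((φ : ℝ) ^ 2 / (1 - OT.erasureProb φ))) - ε) →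
        OT.leakBound φ C₀ m (Real.exp (-(g * n₀))) s ≤
          (3 + s⁻¹) * Real.exp (-(s * g * m)) := by
    intro ε
    by_cases hε : 0 < ε
    · obtain ⟨s, g, h⟩ := OT.exists_leakBound_le φ hε
      exact ⟨s, g, fun _ => h⟩
    -- Arbitrary values for `ε ≤ 0`, so that `choose` yields functions of every real `ε`.
    · exact ⟨0, 0, fun h => absurd h hε⟩
  choose s g hsg using hex
  -- Division by `log 2` converts the leakage from nats to bits.
  refine ⟨fun ε m => (3 + (s ε)⁻¹) / Real.log 2 * Real.exp (-(s ε * g ε * m)), fun ε hε => ?_,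
    fun ε hε n₀ m C₀ hm => ?_⟩
  · obtain ⟨hs, -, hg, -⟩ := hsg ε hε
    exact OT.exponentiallySmall_exp _ (mul_pos hs hg)
  obtain ⟨hs, hs1, hg, hleak⟩ := hsg ε hε
  have hL := hleak n₀ m C₀ hm
  have hη : 0 < Real.exp (-(g ε * n₀)) := Real.exp_pos _
  have hη1 : Real.exp (-(g ε * n₀)) ≤ 1 := Real.exp_le_one_iff.2 (by
    have : 0 ≤ g ε * n₀ := by positivity
    linarith)
  have hf : (3 + (s ε)⁻¹) * Real.exp (-(s ε * g ε * m)) =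
      Real.log 2 * ((3 + (s ε)⁻¹) / Real.log 2 * Real.exp (-(s ε * g ε * m))) := by
    field_simp
  rw [hf] at hL
  refine ⟨fun sel hsel a => ?_, fun sel hsel r n H hH u hu hash hhash a => ?_⟩
  · have h := OT.residual_lawP₀_ge (m := m) φ C₀ sel hsel a hη hη1 hs hs1
    refine le_of_mul_le_mul_left ?_ hl
    rw [mul_sub]
    linarith
  · have h := OT.residual_lawP₁_ge φ C₀ sel (OT.otherIsNoisier_of_honest hsel) hash hhash H hH u hu
      a hη hη1 hs hs1
    have h2 := mul_le_mul_of_nonneg_left hL (Nat.cast_nonneg (α := ℝ) n)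
    refine le_of_mul_le_mul_left ?_ hl
    rw [mul_sub]
    linarith
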